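/- **Definitions.** Let $\kappa$ be an infinite cardinal. For a lattice $L$ let $\mathrm{Con}(L)$, $\mathrm{Filt}(L)$ and $\mathrm{Id}(L)$ be the sets of its congruences, (nonempty) filters and (nonempty) ideals. A triple $\langle\alpha,\beta,\gamma\rangle$ of cardinals is *CFI-represented* by $L$ if $|\mathrm{Con}(L)|=\alpha$, $|\mathrm{Filt}(L)|=\beta$ and $|\mathrm{Id}(L)|=\gamma$. For $p$ a prime or $0$ let $F$ be the prime field of characteristic $p$ (so $F=\mathbb Z/p\mathbb Z$, or $F=\mathbb Q$ if $p=0$), and let $\mathcal F_p$ be the variety of lattices generated by the congruence lattices of all vector spaces over $F$, that is, the class of all lattices satisfying every lattice identity that holds in all these congruence lattices. A lattice $L\in\mathcal F_p$ *generates* $\mathcal F_p$ if $L$ satisfies exactly those lattice identities that hold in all members of $\mathcal F_p$. Let $V$ be a $\kappa$-dimensional vector space over $F$, let $E$ be the lattice of its finite-dimensional subspaces, let $U=E\cup\{V\}$ (ordered by inclusion), and let $B_k$ be the Boolean lattice with $2^k$ elements. The *glued sum* $L_0\dotplus L_1$ of a lattice $L_0$ with greatest element and a lattice $L_1$ with least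 element is obtained by putting $L_1$ on the top of $L_0$ and identifying $1_{L_0}$ with $0_{L_1}$. For nonnegative integers $m,n$ with $m+n\ge 1$ let $$L(p,2^m3^n,\kappa)=\underbrace{U\dotplus\cdots\dotplus U}_{n}\dotplus B_{m-1}\dotplus E,$$ where the summand $B_{m-1}$ is present only if $m\ge 2$ and the summand $E$ is present only if $m\ge 1$. **Theorem.** For every infinite cardinal $\kappa$ the following hold. (a) For every cardinal $\lambda$ with $2\le\lambda\le\kappa$, the triple $\langle\lambda,\kappa,2^\kappa\rangle$ is CFI-represented by some lattice. (b) The triple $\langle 2^\kappa,\kappa,2^\kappa\rangle$ is CFI-represented by some distributive lattice. (c) For each $p$ that is a prime or $0$ and for all nonnegative integers $m,n$ with $m+n\ge 1$, the lattice $L(p,2^m3^n,\kappa)$ is modular, it CFI-represents the triple $\langle 2^m\cdot 3^n,\kappa,2^\kappa\rangle$, it belongs to $\mathcal F_p$, and it generates $\mathcal F_p$. For $m=1$ and $n=0$ this lattice is simple and relatively complemented. -/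

import Mathlib

universe u v w

noncomputable section

namespace CFI

open Cardinal

/-! ### Congruences, filters and ideals of a lattice -/

/-- The triple `⟨α, β, γ⟩` is CFI-represented by the lattice `L`: the lattice has exactly `α`
congruences, `β` filters and `γ` ideals. -/
def IsRepresentedBy (α β γ : Cardinal.{u}) (L : Type u) [Lattice L] : Prop :=
  #(LatticeCon L) = α ∧ #(Order.PFilter L) = β ∧ #(Order.Ideal L) = γ

/-- A lattice is simple if it has exactly two congruences, equality and the full relation. -/
def IsSimple (L : Type u) [Lattice L] : Prop :=
  Nontrivial L ∧ ∀ θ : LatticeCon L, (∀ x y, θ.r x y → x = y) ∨ (∀ x y, θ.r x y)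

/-- A lattice is relatively complemented if in every interval `[a, b]` each element
has a complement. -/
def IsRelativelyComplemented (L : Type u) [Lattice L] : Prop :=
  ∀ a b x : L, a ≤ x → x ≤ b → ∃ y, x ⊓ y = a ∧ x ⊔ y = b

/-! ### Lattice identities and varieties of lattices -/

/-- Lattice terms in the variables `x₀, x₁, x₂, …`. -/
inductive LatticeTerm : Type
  | var (i : ℕ) : LatticeTerm
  | join (s t : LatticeTerm) : LatticeTerm
  | meet (s t : LatticeTerm) : LatticeTerm

/-- The value of a lattice term under an assignment of the variables. -/
def LatticeTerm.eval {L : Type u} [Lattice L] (a : ℕ → L) : LatticeTerm → L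
  | .var i => a i
  | .join s t => s.eval a ⊔ t.eval a
  | .meet s t => s.eval a ⊓ t.eval a

/-- The lattice identity `s = t` holds in `L`. -/
def Satisfies (L : Type u) [Lattice L] (s t : LatticeTerm) : Prop :=
  ∀ a : ℕ → L, s.eval a = t.eval a

/-- A class of lattices. -/
def LatticeClass : Type (u + 1) := (L : Type u) → [Lattice L] → Prop

/-- The variety generated by a class `𝒦` of lattices: all lattices that satisfy every identity
that holds in all members of `𝒦`. -/
def varietyGeneratedBy (𝒦 : LatticeClass.{u}) : LatticeClass.{u} := fun L _ =>
  ∀ s t : LatticeTerm, (∀ (M : Type u) [Lattice M], 𝒦 M → Satisfies M s t) → Satisfies L s t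

/-- A lattice `L` in the variety `𝒱` generates `𝒱` if it satisfies exactly those lattice identities
that are satisfied by all members of `𝒱`. -/
def Generates (L : Type u) [Lattice L] (𝒱 : LatticeClass.{u}) : Prop :=
  ∀ s t : LatticeTerm, Satisfies L s t ↔ ∀ (M : Type u) [Lattice M], 𝒱 M → Satisfies M s t

/-! ### Congruence lattices of vector spaces and the congruence varieties `F_p` -/

section Congruences

variable {K : Type v} {V : Type w} [Field K] [AddCommGroup V] [Module K V]

theorem toAddCon_injective :
    Function.Injective (ModuleCon.toAddCon : ModuleCon K V → AddCon V) := by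
  rintro ⟨c, hc⟩ ⟨d, hd⟩ h
  cases h
  rfl

/-- Congruences of a vector space are ordered by inclusion. -/
instance : PartialOrder (ModuleCon K V) :=
  PartialOrder.lift ModuleCon.toAddCon toAddCon_injective

instance : InfSet (ModuleCon K V) where
  sInf S :=
    { sInf (ModuleCon.toAddCon '' S) with
      smul := by
        rintro k x y h _ ⟨c, hc, rfl⟩
        exact c.smul k (h _ ⟨c, hc, rfl⟩) }

/-- The congruence lattice of a vector space. -/
instance : CompleteLattice (ModuleCon K V) :=
  completeLatticeOfInf _ fun S =>
    ⟨fun c hc x y h => h _ ⟨c, hc, rfl⟩, fun d hd x y h => by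
      rintro _ ⟨c, hc, rfl⟩
      exact hd hc h⟩

end Congruences

/-- The congruence variety determined by the variety of all vector spaces over the field `K`, that
is, the lattice variety generated by the congruence lattices of these vector spaces. -/
def congruenceVariety (K : Type) [Field K] : LatticeClass.{u} :=
  varietyGeneratedBy fun M _ =>
    ∃ (V : Type u) (_ : AddCommGroup V) (_ : Module K V), Nonempty (M ≃o ModuleCon K V)

/-- The prime field of characteristic `p`: the field of rational numbers if `p = 0`, and the field
of residue classes modulo `p` if `p` is a prime. -/
def PrimeField : ℕ → Type
  | 0 => ℚ
  | p + 1 => ZMod (p + 1)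

instance (p : ℕ) [hp : Fact (p = 0 ∨ p.Prime)] : Field (PrimeField p) :=
  match p, hp with
  | 0, _ => inferInstanceAs (Field ℚ)
  | p + 1, hp =>
    haveI : Fact (p + 1).Prime := ⟨hp.out.resolve_left p.succ_ne_zero⟩
    inferInstanceAs (Field (ZMod (p + 1)))

/-- The congruence variety `F_p`. -/
def freeseVariety (p : ℕ) [Fact (p = 0 ∨ p.Prime)] : LatticeClass.{u} :=
  congruenceVariety (PrimeField p)

/-! ### Lattices of finite-dimensional subspaces -/

section Subspaces

variable (K : Type v) (V : Type w) [Field K] [AddCommGroup V] [Module K V]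

/-- The lattice of all finite-dimensional subspaces of `V`. -/
def finDim : Sublattice (Submodule K V) where
  carrier := {W | FiniteDimensional K W}
  supClosed' := by
    intro A hA B hB
    have : FiniteDimensional K A := hA
    have : FiniteDimensional K B := hB
    exact Submodule.finiteDimensional_sup A B
  infClosed' := by
    intro A hA B _
    have : FiniteDimensional K A := hA
    exact Submodule.finiteDimensional_inf_left A B

/-- The lattice of all finite-dimensional subspaces of `V` together with `V` itself. -/
def finDimTop : Sublattice (Submodule K V) where
  carrier := {W | FiniteDimensional K W ∨ W = ⊤}
  supClosed' := by
    rintro A (hA | rfl) B (hB | rfl)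
    · exact .inl ((finDim K V).supClosed hA hB)
    all_goals exact .inr (by simp)
  infClosed' := by
    rintro A (hA | rfl) B (hB | rfl)
    · exact .inl ((finDim K V).infClosed hA hB)
    · rw [inf_top_eq]; exact .inl hA
    · rw [top_inf_eq]; exact .inl hB
    · exact .inr (by simp)

instance : OrderBot (finDim K V) where
  bot := ⟨⊥, inferInstanceAs (FiniteDimensional K (⊥ : Submodule K V))⟩
  bot_le W := bot_le (a := (W : Submodule K V))

instance : OrderBot (finDimTop K V) where
  bot := ⟨⊥, .inl (inferInstanceAs (FiniteDimensional K (⊥ : Submodule K V)))⟩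
  bot_le W := bot_le (a := (W : Submodule K V))

instance : OrderTop (finDimTop K V) where
  top := ⟨⊤, .inr rfl⟩
  le_top W := le_top (a := (W : Submodule K V))

end Subspaces

/-! ### Glued sums -/

section GluedSum

variable (A : Type v) (B : Type w) [Lattice A] [OrderTop A] [Lattice B] [OrderBot B]

/-- The glued sum of a lattice `A` with greatest element and a lattice `B` with least element: `B`
is put on the top of `A`, and the greatest element of `A` is identified with the least element of
`B`. An element `a` of `A` is represented by `(a, ⊥)`, an element `b` of `B` by `(⊤, b)`, and the
common element is `(⊤, ⊥)`; see `gluedSum_spec`. -/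
def gluedSum : Sublattice (A × B) where
  carrier := {x | x.1 = ⊤ ∨ x.2 = ⊥}
  supClosed' := by
    rintro ⟨a, b⟩ (h | h) ⟨c, d⟩ (h' | h') <;> simp_all
  infClosed' := by
    rintro ⟨a, b⟩ (h | h) ⟨c, d⟩ (h' | h') <;> simp_all

instance [OrderBot A] : OrderBot (gluedSum A B) where
  bot := ⟨(⊥, ⊥), .inr rfl⟩
  bot_le x := bot_le (a := (x : A × B))

/-- The glued sum is the union of a copy of `A` and a copy of `B`, every element of the former is
below every element of the latter, and the copies are glued along `⊤ = ⊥`. -/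
theorem gluedSum_spec : ∃ (f : A ↪o gluedSum A B) (g : B ↪o gluedSum A B),
    f ⊤ = g ⊥ ∧ (∀ a b, f a ≤ g b) ∧ Set.range f ∪ Set.range g = Set.univ := by
  refine ⟨OrderEmbedding.ofMapLEIff (fun a => ⟨(a, ⊥), .inr rfl⟩) fun a b => ?_,
    OrderEmbedding.ofMapLEIff (fun b => ⟨(⊤, b), .inl rfl⟩) fun a b => ?_, rfl, fun a b => ?_, ?_⟩
  · simp [← Subtype.coe_le_coe]
  · simp [← Subtype.coe_le_coe]
  · exact ⟨le_top (a := a), bot_le (a := b)⟩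
  · ext ⟨⟨a, b⟩, h⟩
    rcases h with h | h <;> simp at h <;> subst h
    · exact iff_of_true (.inr ⟨b, rfl⟩) trivial
    · exact iff_of_true (.inl ⟨a, rfl⟩) trivial

end GluedSum

/-! ### The lattices `L(p, 2^m * 3^n, κ)` -/

/-- A lattice with least element. -/
structure LatticeWithBot : Type (u + 1) where
  carrier : Type u
  [lattice : Lattice carrier]
  [orderBot : OrderBot carrier]

attribute [instance] LatticeWithBot.lattice LatticeWithBot.orderBot

/-- With `E` the lattice of finite-dimensional subspaces of `V`, `U` the lattice obtained from `E`
by adding `V`, and `B_k` the Boolean lattice of all subsets of a `k`-element set, the glued sum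
`U ∔ ⋯ ∔ U ∔ B_{m-1} ∔ E` with `n` summands `U`, where the summand `B_{m-1}` is present only
if `m ≥ 2` and the summand `E` is present only if `m ≥ 1`. (The empty sum, `m = n = 0`, is set to
be the one-element lattice.) -/
def tower (K : Type) (V : Type u) [Field K] [AddCommGroup V] [Module K V] :
    (m n : ℕ) → LatticeWithBot.{u}
  | 0, 0 => ⟨PUnit⟩
  | 1, 0 => ⟨finDim K V⟩
  | m + 2, 0 => ⟨gluedSum (Set (Fin (m + 1))) (finDim K V)⟩
  | 0, 1 => ⟨finDimTop K V⟩
  | 0, n + 2 => ⟨gluedSum (finDimTop K V) (tower K V 0 (n + 1)).carrier⟩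
  | m + 1, n + 1 => ⟨gluedSum (finDimTop K V) (tower K V (m + 1) n).carrier⟩

/-- The lattice `L(p, 2^m * 3^n, κ)`: the tower over the `κ`-dimensional vector space of all finitely
supported functions from a set of cardinality `κ` to the prime field of characteristic `p`. -/
def towerLattice (p m n : ℕ) [Fact (p = 0 ∨ p.Prime)] (κ : Cardinal.{u}) : Type u :=
  (tower (PrimeField p) (κ.out →₀ PrimeField p) m n).carrier

instance (p m n : ℕ) [Fact (p = 0 ∨ p.Prime)] (κ : Cardinal.{u}) :
    Lattice (towerLattice p m n κ) :=
  (tower (PrimeField p) (κ.out →₀ PrimeField p) m n).lattice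

end CFI

end

/-!
Filters are mostly counted by the descending chain condition and ideals by an embedding: a well-
founded lattice has only principal filters (`mk_pfilter`), and the lattice `E` of finite-dimensional
subspaces of a space of infinite dimension `κ` over a countable field has `κ` elements but `2 ^ κ`
ideals (`mk_ideal_finDim`), because the subspaces spanned by different sets of basis vectors give
different ideals. Any lattice with `κ` elements that contains `E` therefore has `2 ^ κ` ideals
(`mk_ideal_le_of_embedding`).

The lattice `E` is relatively complemented, so a nontrivial congruence collapses some line to zero;
every other line `W` lies in the join of that line with a third one disjoint from `W`, so all lines
collapse and `E` is simple (`finDim_isSimple`). Adding the whole space on top gives one more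
congruence (`card_latticeCon_finDimTop`). Congruences of a glued sum are pairs of congruences of the
summands (`gluedConEquiv`), whence `2 ^ m * 3 ^ n` congruences in the towers.

For the varieties, congruences of a vector space correspond to subspaces
(`submoduleEquivModuleCon`), and membership of a vector in the value of a lattice term is witnessed
inside a finite-dimensional subspace (`exists_mem_eval`). Hence an identity of `E` holds in all
subspace lattices over the same field (`Satisfies.submodule`), and the summands of a tower, being
sublattices of subspace lattices or powers of the two-element lattice, satisfy the identities of `E`
as well. Modularity is itself an identity.

For a prescribed number of congruences, `E` is wrapped into layers `{0, c, c', 1}` indexed by a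
well-order `I`, where the earlier layers and `E` are put strictly between `0` and `1` and are
complementary to the atoms `c` and `c'` (`Nest`). Identifying an element of a layer with any other
element collapses everything up to that layer, so besides equality there is exactly one congruence
for each lower set of `I`, that is, `#I + 2` congruences altogether (`Nest.mk_latticeCon`,
`mk_lowerSet`). The least elements of the layers form a descending chain, but this adds only `#I + 1`
filters. The distributive example consists of the finite subsets of a set of cardinality `κ`.
-/

namespace CFI

open Cardinal

/-! ### Congruences of a lattice -/

section Con

variable {L : Type u} [Lattice L]

theorem latticeCon_ext {θ ψ : LatticeCon L} (h : ∀ x y, θ.r x y ↔ ψ.r x y) : θ = ψ := by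
  obtain ⟨s, _, _⟩ := θ
  obtain ⟨t, _, _⟩ := ψ
  congr
  exact Setoid.ext h

theorem r_inf_left {θ : LatticeCon L} {x y : L} (h : θ.r x y) (z : L) : θ.r (z ⊓ x) (z ⊓ y) :=
  θ.inf (θ.refl z) h

theorem r_sup_left {θ : LatticeCon L} {x y : L} (h : θ.r x y) (z : L) : θ.r (z ⊔ x) (z ⊔ y) :=
  θ.sup (θ.refl z) h

/-- The classes of a lattice congruence are convex. -/
theorem r_of_mem_Icc {θ : LatticeCon L} {a b x y : L} (h : θ.r a b) (hx : x ∈ Set.Icc a b)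
    (hy : y ∈ Set.Icc a b) : θ.r x y := by
  have key : ∀ z ∈ Set.Icc a b, θ.r a z := fun z hz => by
    simpa [inf_eq_right.2 hz.1, inf_eq_left.2 hz.2] using r_inf_left h z
  exact θ.trans (θ.symm (key x hx)) (key y hy)

variable (L) in
/-- The equality congruence. -/
def eqCon : LatticeCon L where
  toSetoid := ⊥
  inf h₁ h₂ := congrArg₂ (· ⊓ ·) h₁ h₂
  sup h₁ h₂ := congrArg₂ (· ⊔ ·) h₁ h₂

variable (L) in
/-- The congruence that identifies all elements. -/
def fullCon : LatticeCon L where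
  toSetoid := ⊤
  inf _ _ := trivial
  sup _ _ := trivial

theorem eqCon_r {x y : L} : (eqCon L).r x y ↔ x = y := Iff.rfl

theorem fullCon_r (x y : L) : (fullCon L).r x y := trivial

/-- The preimage of a congruence under a lattice homomorphism. -/
def comapCon {M : Type v} [Lattice M] (f : LatticeHom L M) (θ : LatticeCon M) : LatticeCon L where
  toSetoid := θ.toSetoid.comap f
  inf h₁ h₂ := by
    simp only [Setoid.comap_rel, map_inf] at *
    exact θ.inf h₁ h₂
  sup h₁ h₂ := by
    simp only [Setoid.comap_rel, map_sup] at *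
    exact θ.sup h₁ h₂

theorem comapCon_r {M : Type v} [Lattice M] {f : LatticeHom L M} {θ : LatticeCon M} {x y : L} :
    (comapCon f θ).r x y ↔ θ.r (f x) (f y) := Iff.rfl

theorem IsSimple.eq_or_eq (hL : IsSimple L) (θ : LatticeCon L) : θ = eqCon L ∨ θ = fullCon L :=
  (hL.2 θ).imp
    (fun h => latticeCon_ext fun x y => ⟨h x y, fun e => eqCon_r.1 e ▸ θ.refl x⟩)
    (fun h => latticeCon_ext fun x y => ⟨fun _ => fullCon_r x y, fun _ => h x y⟩)

theorem eqCon_ne_fullCon [Nontrivial L] : eqCon L ≠ fullCon L := by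
  intro h
  obtain ⟨x, y, hxy⟩ := exists_pair_ne L
  exact hxy (eqCon_r.1 (h ▸ fullCon_r x y))

theorem IsSimple.card_latticeCon (hL : IsSimple L) : Nat.card (LatticeCon L) = 2 := by
  have := hL.1
  rw [← Set.ncard_univ, Set.ncard_eq_two]
  exact ⟨_, _, eqCon_ne_fullCon, Set.eq_univ_of_forall (fun θ => hL.eq_or_eq θ) |>.symm⟩

end Con

/-! ### Congruences of glued sums and of finite Boolean lattices -/

section GluedSum

variable (A : Type v) (B : Type w) [Lattice A] [OrderTop A] [Lattice B] [OrderBot B]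

/-- The inclusion of the lower summand into a glued sum. -/
def gluedInl : LatticeHom A (gluedSum A B) where
  toFun a := ⟨(a, ⊥), .inr rfl⟩
  map_sup' a b := by ext <;> simp
  map_inf' a b := by ext <;> simp

/-- The inclusion of the upper summand into a glued sum. -/
def gluedInr : LatticeHom B (gluedSum A B) where
  toFun b := ⟨(⊤, b), .inl rfl⟩
  map_sup' a b := by ext <;> simp
  map_inf' a b := by ext <;> simp

theorem gluedInr_injective : Function.Injective (gluedInr A B) := fun _ _ h =>
  congrArg (fun x : gluedSum A B => x.1.2) h

/-- The restriction of a product congruence to the glued sum. -/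
def gluedCon (α : LatticeCon A) (β : LatticeCon B) : LatticeCon (gluedSum A B) where
  r x y := α.r x.1.1 y.1.1 ∧ β.r x.1.2 y.1.2
  iseqv := ⟨fun _ => ⟨α.refl _, β.refl _⟩, fun h => ⟨α.symm h.1, β.symm h.2⟩,
    fun h₁ h₂ => ⟨α.trans h₁.1 h₂.1, β.trans h₁.2 h₂.2⟩⟩
  inf h₁ h₂ := ⟨α.inf h₁.1 h₂.1, β.inf h₁.2 h₂.2⟩
  sup h₁ h₂ := ⟨α.sup h₁.1 h₂.1, β.sup h₁.2 h₂.2⟩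

/-- A congruence of a glued sum is determined by its restrictions to the two summands, which are
arbitrary: meeting and joining with the glueing point projects onto the summands. -/
def gluedConEquiv : LatticeCon (gluedSum A B) ≃ LatticeCon A × LatticeCon B where
  toFun θ := (comapCon (gluedInl A B) θ, comapCon (gluedInr A B) θ)
  invFun p := gluedCon A B p.1 p.2
  left_inv θ := by
    refine latticeCon_ext fun x y => ⟨fun ⟨h₁, h₂⟩ => ?_, fun h => ⟨?_, ?_⟩⟩
    · obtain ⟨⟨a, b⟩, hab⟩ := x
      obtain ⟨⟨c, d⟩, hcd⟩ := y
      rw [comapCon_r] at h₁ h₂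
      -- Elements of different summands are compared through the glueing point `(⊤, ⊥)`.
      rcases hab with hab | hab <;> rcases hcd with hcd | hcd <;> dsimp only at hab hcd <;>
        subst hab <;> subst hcd
      · exact h₂
      · exact θ.trans h₂ h₁
      · exact θ.trans h₁ h₂
      · exact h₁
    · have := r_inf_left h (gluedInl A B ⊤)
      rw [comapCon_r]
      convert this using 1 <;> ext <;> simp [gluedInl]
    · have := r_sup_left h (gluedInl A B ⊤)
      rw [comapCon_r]
      convert this using 1 <;> ext <;> simp [gluedInl, gluedInr]
  right_inv p := by
    refine Prod.ext (latticeCon_ext fun x y => ?_) (latticeCon_ext fun x y => ?_)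
    · exact and_iff_left (p.2.refl _)
    · exact and_iff_right (p.1.refl _)

theorem card_latticeCon_gluedSum :
    Nat.card (LatticeCon (gluedSum A B)) = Nat.card (LatticeCon A) * Nat.card (LatticeCon B) := by
  rw [Nat.card_congr (gluedConEquiv A B), Nat.card_prod]

end GluedSum

/-- The congruence of a lattice of subsets that identifies two subsets if they agree outside `S`. -/
def sdiffCon {ι : Type u} (S : Set ι) : LatticeCon (Set ι) where
  r X Y := X ∪ S = Y ∪ S
  iseqv := ⟨fun _ => rfl, fun h => h.symm, fun h₁ h₂ => h₁.trans h₂⟩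
  inf {W X Y Z} h₁ h₂ := by
    change W ∩ Y ∪ S = X ∩ Z ∪ S
    rw [Set.inter_union_distrib_right, h₁, h₂, ← Set.inter_union_distrib_right]
  sup {W X Y Z} h₁ h₂ := by
    change W ∪ Y ∪ S = X ∪ Z ∪ S
    rw [Set.union_union_distrib_right, h₁, h₂, ← Set.union_union_distrib_right]

/-- A congruence of a finite Boolean lattice is determined by the atoms that it identifies with
the least element. -/
def setConEquiv (ι : Type u) [Finite ι] : LatticeCon (Set ι) ≃ Set ι where
  toFun θ := {i | θ.r ∅ {i}}
  invFun := sdiffCon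
  left_inv θ := by
    refine latticeCon_ext fun X Y => ?_
    -- The union of all atoms congruent to `∅` is congruent to `∅`, as `ι` is finite.
    have key : ∀ T : Set ι, T ⊆ {i | θ.r ∅ {i}} → θ.r ∅ T := fun T => by
      induction T, T.toFinite using Set.Finite.induction_on with
      | empty => exact fun _ => θ.refl _
      | @insert i T _ _ ih =>
        intro h
        rw [Set.insert_subset_iff] at h
        simpa using θ.sup h.1 (ih h.2)
    have mono : ∀ {X Y : Set ι}, θ.r X Y → ∀ i ∈ X, i ∈ Y ∪ {i | θ.r ∅ {i}} := by
      intro X Y h i hi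
      by_contra hn
      simp only [Set.mem_union, Set.mem_ofPred_eq, not_or] at hn
      have h' := r_inf_left h {i}
      rw [show ({i} ⊓ X : Set ι) = {i} from Set.singleton_inter_of_mem hi,
        show ({i} ⊓ Y : Set ι) = ∅ from Set.singleton_inter_eq_empty.2 hn.1] at h'
      exact hn.2 (θ.symm h')
    refine ⟨fun h => ?_, fun h => ?_⟩
    · have hX := θ.sup (θ.refl X) (key _ subset_rfl)
      have hY := θ.sup (θ.refl Y) (key _ subset_rfl)
      simp only [Set.sup_eq_union, Set.union_empty] at hX hY
      have h : X ∪ {i | θ.r ∅ {i}} = Y ∪ {i | θ.r ∅ {i}} := h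
      rw [h] at hX
      exact θ.trans hX (θ.symm hY)
    · exact Set.Subset.antisymm
        (Set.union_subset (mono h) Set.subset_union_right)
        (Set.union_subset (mono (θ.symm h)) Set.subset_union_right)
  right_inv S := by
    ext i
    change ∅ ∪ S = {i} ∪ S ↔ i ∈ S
    rw [Set.empty_union, Set.singleton_union, eq_comm, Set.insert_eq_self]

theorem card_latticeCon_set (ι : Type u) [Finite ι] :
    Nat.card (LatticeCon (Set ι)) = 2 ^ Nat.card ι := by
  have := Fintype.ofFinite ι
  rw [Nat.card_congr (setConEquiv ι), Nat.card_eq_fintype_card, Fintype.card_set,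
    Nat.card_eq_fintype_card]

/-! ### The numbers of filters and ideals -/

theorem mk_latticeCon_le (L : Type u) [Lattice L] [Infinite L] : #(LatticeCon L) ≤ 2 ^ #L := by
  have h : Function.Injective fun (θ : LatticeCon L) => {p : L × L | θ.r p.1 p.2} :=
    fun θ ψ h => latticeCon_ext fun x y => Set.ext_iff.1 h (x, y)
  refine (mk_le_of_injective h).trans ?_
  rw [mk_set, ← mul_def, mul_eq_self (aleph0_le_mk L)]

section Counting

variable (L : Type u) [Lattice L]

theorem mk_le_mk_pfilter : #L ≤ #(Order.PFilter L) := by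
  refine mk_le_of_injective (f := Order.PFilter.principal) fun x y h => ?_
  exact le_antisymm (Order.PFilter.principal_le_principal_iff.1 h.ge)
    (Order.PFilter.principal_le_principal_iff.1 h.le)

/-- A minimal element of a filter generates it. -/
theorem eq_principal_of_minimal {L : Type u} [Lattice L] {F : Order.PFilter L} {x : L} (hx : x ∈ F)
    (hmin : ∀ y ∈ F, ¬ y < x) : F = Order.PFilter.principal x := by
  refine Order.PFilter.ext _ _ (Set.ext fun y => ⟨fun hy => ?_, fun hy => F.mem_of_le hy hx⟩)
  have h := Order.PFilter.inf_mem hx hy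
  have h' : x ⊓ y = x := by
    by_contra hne
    exact hmin _ h (lt_of_le_of_ne inf_le_left hne)
  exact inf_eq_left.1 h'

/-- In a well-founded lattice every filter is principal. -/
theorem mk_pfilter [WellFoundedLT L] : #(Order.PFilter L) = #L := by
  refine le_antisymm (mk_le_of_surjective (f := Order.PFilter.principal) fun F => ?_)
    (mk_le_mk_pfilter L)
  obtain ⟨x, hx, hmin⟩ := wellFounded_lt.has_min (F : Set L) F.nonempty
  exact ⟨x, (eq_principal_of_minimal hx hmin).symm⟩

theorem mk_ideal_le : #(Order.Ideal L) ≤ 2 ^ #L := by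
  rw [← mk_set]
  exact mk_le_of_injective (f := fun I : Order.Ideal L => (I : Set L)) SetLike.coe_injective

variable {L}

/-- Distinct ideals generate distinct ideals in a larger lattice. -/
theorem mk_ideal_le_of_embedding {M : Type u} [Lattice M] (f : L ↪o M) :
    #(Order.Ideal L) ≤ #(Order.Ideal M) := by
  have hI : ∀ I : Order.Ideal L, Order.IsIdeal {y : M | ∃ x ∈ I, y ≤ f x} := fun I => by
    refine ⟨fun a b hab ⟨x, hx, h⟩ => ⟨x, hx, hab.trans h⟩, ?_, ?_⟩
    · obtain ⟨x, hx⟩ := I.nonempty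
      exact ⟨f x, x, hx, le_rfl⟩
    · rintro a ⟨x, hx, hax⟩ b ⟨y, hy, hby⟩
      have hxy := Order.Ideal.sup_mem hx hy
      exact ⟨_, ⟨_, hxy, le_rfl⟩, hax.trans (f.monotone le_sup_left),
        hby.trans (f.monotone le_sup_right)⟩
  refine mk_le_of_injective (f := fun I => (hI I).toIdeal) fun I J h => ?_
  have key : ∀ {I J : Order.Ideal L}, (hI I).toIdeal = (hI J).toIdeal → ∀ x ∈ I, x ∈ J := by
    intro I J h x hx
    have : f x ∈ (hI J).toIdeal := h ▸ ⟨x, hx, le_rfl⟩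
    obtain ⟨y, hy, hxy⟩ := this
    exact J.lower (f.le_iff_le.1 hxy) hy
  exact Order.Ideal.ext (Set.ext fun x => ⟨key h x, key h.symm x⟩)

/-- An injective lattice homomorphism as an order embedding. -/
def embeddingOfHom {M : Type v} [Lattice M] (f : LatticeHom L M) (hf : Function.Injective f) :
    L ↪o M :=
  OrderEmbedding.ofMapLEIff f fun a b => by rw [← inf_eq_left, ← map_inf, hf.eq_iff, inf_eq_left]

end Counting

/-! ### Nested lattices -/

/-- The nested lattice with core `S` and layers indexed by a linear order `I`. Each layer is a copy
of the four-element Boolean lattice `Bool × Bool`; the core and all earlier layers lie strictly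
between the least and the greatest element of a layer and are incomparable with its two atoms. -/
inductive Nest (S I : Type u) : Type u
  | core (a : S) : Nest S I
  | layer (i : I) (s : Bool × Bool) : Nest S I

namespace Nest

variable {S I : Type u} [Lattice S] [LinearOrder I]

/-- The order of a nested lattice. -/
protected def le : Nest S I → Nest S I → Prop
  | core a, core b => a ≤ b
  | core _, layer _ t => t = ⊤
  | layer _ s, core _ => s = ⊥
  | layer i s, layer j t => i < j ∧ t = ⊤ ∨ j < i ∧ s = ⊥ ∨ i = j ∧ s ≤ t

/-- The join in a nested lattice. -/
protected def sup : Nest S I → Nest S I → Nest S I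
  | core a, core b => core (a ⊔ b)
  | core a, layer i t => if t = ⊥ then core a else layer i ⊤
  | layer i s, core b => if s = ⊥ then core b else layer i ⊤
  | layer i s, layer j t =>
    if i = j then layer i (s ⊔ t)
    else if i < j then (if t = ⊥ then layer i s else layer j ⊤)
    else (if s = ⊥ then layer j t else layer i ⊤)

/-- The meet in a nested lattice. -/
protected def inf : Nest S I → Nest S I → Nest S I
  | core a, core b => core (a ⊓ b)
  | core a, layer i t => if t = ⊤ then core a else layer i ⊥
  | layer i s, core b => if s = ⊤ then core b else layer i ⊥
  | layer i s, layer j t =>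
    if i = j then layer i (s ⊓ t)
    else if i < j then (if t = ⊤ then layer i s else layer j ⊥)
    else (if s = ⊤ then layer j t else layer i ⊥)

instance : PartialOrder (Nest S I) where
  le := Nest.le
  le_refl x := by cases x <;> simp [Nest.le]
  le_trans x y z h₁ h₂ := by
    have hne : (⊥ : Bool × Bool) ≠ ⊤ := by decide
    have hbot : ∀ s : Bool × Bool, ⊥ ≤ s ∧ (s ≤ ⊥ → s = ⊥) := fun s => ⟨bot_le, le_bot_iff.1⟩
    have htop : ∀ s : Bool × Bool, s ≤ ⊤ ∧ (⊤ ≤ s → s = ⊤) := fun s => ⟨le_top, top_le_iff.1⟩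
    have hB : ∀ s t u : Bool × Bool, s ≤ t → t ≤ u → s ≤ u := fun s t u => le_trans
    have hS : ∀ s t u : S, s ≤ t → t ≤ u → s ≤ u := fun s t u => le_trans
    cases x <;> cases y <;> cases z <;> simp only [Nest.le] at * <;> grind
  le_antisymm x y h₁ h₂ := by
    have hne : (⊥ : Bool × Bool) ≠ ⊤ := by decide
    have hB : ∀ s t : Bool × Bool, s ≤ t → t ≤ s → s = t := fun s t => le_antisymm
    have hS : ∀ s t : S, s ≤ t → t ≤ s → s = t := fun s t => le_antisymm
    cases x <;> cases y <;> simp only [Nest.le] at * <;> grind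

theorem le_def {x y : Nest S I} : x ≤ y ↔ Nest.le x y := Iff.rfl

instance : Lattice (Nest S I) where
  sup := Nest.sup
  inf := Nest.inf
  le_sup_left x y := by
    rw [le_def]
    cases x <;> cases y <;> simp only [Nest.sup] <;> (try split_ifs) <;> simp_all [Nest.le]
    all_goals grind
  le_sup_right x y := by
    rw [le_def]
    cases x <;> cases y <;> simp only [Nest.sup] <;> (try split_ifs) <;> simp_all [Nest.le]
    all_goals grind
  sup_le x y z h₁ h₂ := by
    rw [le_def] at *
    cases x <;> cases y <;> cases z <;> simp only [Nest.sup] <;> (try split_ifs) <;>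
      simp_all [Nest.le]
    all_goals grind
  inf_le_left x y := by
    rw [le_def]
    cases x <;> cases y <;> simp only [Nest.inf] <;> (try split_ifs) <;> simp_all [Nest.le]
    all_goals grind
  inf_le_right x y := by
    rw [le_def]
    cases x <;> cases y <;> simp only [Nest.inf] <;> (try split_ifs) <;> simp_all [Nest.le]
    all_goals grind
  le_inf x y z h₁ h₂ := by
    rw [le_def] at *
    cases x <;> cases y <;> cases z <;> simp only [Nest.inf] <;> (try split_ifs) <;>
      simp_all [Nest.le]
    all_goals grind

end Nest

namespace Nest

variable {S I : Type u} [Lattice S] [LinearOrder I]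

theorem layer_sup_layer (i : I) (s t : Bool × Bool) :
    (layer i s ⊔ layer i t : Nest S I) = layer i (s ⊔ t) := if_pos rfl

theorem layer_inf_layer (i : I) (s t : Bool × Bool) :
    (layer i s ⊓ layer i t : Nest S I) = layer i (s ⊓ t) := if_pos rfl

variable (S I) in
/-- The inclusion of the core into a nested lattice. -/
def coreHom : LatticeHom S (Nest S I) where
  toFun := core
  map_sup' _ _ := rfl
  map_inf' _ _ := rfl

/-- The element `x` lies in the core or in a layer with index less than `i`. -/
def Below (i : I) : Nest S I → Prop
  | core _ => True
  | layer j _ => j < i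

/-- The element `x` lies in the core or in a layer with index in `D`. -/
def Inside (D : LowerSet I) : Nest S I → Prop
  | core _ => True
  | layer j _ => j ∈ D

section Below

variable {i : I} {x : Nest S I}

theorem Below.layer_bot_le (hx : Below i x) : layer i ⊥ ≤ x := by
  rw [le_def]
  cases x <;> simp_all [Below, Nest.le]

theorem Below.le_layer_top (hx : Below i x) : x ≤ layer i ⊤ := by
  rw [le_def]
  cases x <;> simp_all [Below, Nest.le]

theorem Below.layer_sup (hx : Below i x) {s : Bool × Bool} (hs : s ≠ ⊥) :
    layer i s ⊔ x = layer i ⊤ := by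
  change Nest.sup _ _ = _
  cases x <;> simp only [Below, Nest.sup] at * <;> grind

theorem Below.layer_inf (hx : Below i x) {s : Bool × Bool} (hs : s ≠ ⊤) :
    layer i s ⊓ x = layer i ⊥ := by
  change Nest.inf _ _ = _
  cases x <;> simp only [Below, Nest.inf] at * <;> grind

variable {θ : LatticeCon (Nest S I)}

/-- The atoms of the layer are complements of `x`, so identifying `x` with the greatest element of
the layer identifies both atoms with the least element. -/
theorem Below.collapse_of_top (hx : Below i x) (h : θ.r (layer i ⊤) x) :
    θ.r (layer i ⊥) (layer i ⊤) := by
  have key : ∀ s : Bool × Bool, s ≠ ⊤ → θ.r (layer i s) (layer i ⊥) := fun s hs => by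
    have := r_inf_left h (layer i s)
    rwa [layer_inf_layer, inf_top_eq, hx.layer_inf hs] at this
  have := θ.sup (key (true, false) (by decide)) (key (false, true) (by decide))
  rw [layer_sup_layer, layer_sup_layer] at this
  exact θ.symm this

/-- The dual of `Below.collapse_of_top`. -/
theorem Below.collapse_of_bot (hx : Below i x) (h : θ.r (layer i ⊥) x) :
    θ.r (layer i ⊥) (layer i ⊤) := by
  have key : ∀ s : Bool × Bool, s ≠ ⊥ → θ.r (layer i s) (layer i ⊤) := fun s hs => by
    have := r_sup_left h (layer i s)
    rwa [layer_sup_layer, sup_bot_eq, hx.layer_sup hs] at this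
  have := θ.inf (key (true, false) (by decide)) (key (false, true) (by decide))
  rwa [layer_inf_layer, layer_inf_layer] at this

theorem Below.collapse (hx : Below i x) {s : Bool × Bool} (h : θ.r (layer i s) x) :
    θ.r (layer i ⊥) (layer i ⊤) := by
  by_cases hs : s = ⊥
  · exact hx.collapse_of_bot (hs ▸ h)
  · have := r_sup_left (θ.symm h) x
    rw [sup_idem, sup_comm, hx.layer_sup hs] at this
    exact hx.collapse_of_top (θ.symm this)

/-- Identifying two elements of one layer identifies the least or the greatest one of them with the
core. -/
theorem collapse_of_ne [Nonempty S] {s t : Bool × Bool} (hst : s ≠ t)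
    (h : θ.r (layer i s) (layer i t)) : θ.r (layer i ⊥) (layer i ⊤) := by
  obtain ⟨a⟩ := ‹Nonempty S›
  have ha : Below i (core a : Nest S I) := trivial
  have key : ∀ {t : Bool × Bool}, t ≠ ⊥ → θ.r (layer i ⊥) (layer i t) →
      θ.r (layer i ⊥) (layer i ⊤) := fun {t} ht h => by
    have := r_sup_left h (core a)
    rw [sup_eq_left.2 ha.layer_bot_le, sup_comm, ha.layer_sup ht] at this
    exact ha.collapse_of_top (θ.symm this)
  have key' : ∀ {s t : Bool × Bool}, ¬ s ≤ t → θ.r (layer i s) (layer i t) →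
      θ.r (layer i ⊥) (layer i ⊤) := fun {s t} hst h => by
    by_cases hs : s = ⊤
    · have := r_inf_left h (core a)
      subst hs
      rw [inf_eq_left.2 ha.le_layer_top, inf_comm, ha.layer_inf (by rintro rfl; exact hst le_rfl)]
        at this
      exact ha.collapse_of_bot (θ.symm this)
    · have hst' : s ⊓ t = ⊥ := by
        clear h
        revert s t
        decide
      have := r_inf_left h (layer i s)
      rw [layer_inf_layer, layer_inf_layer, inf_idem, hst'] at this
      exact key (by rintro rfl; exact hst bot_le) (θ.symm this)
  by_cases hle : s ≤ t
  · exact key' (fun h' => hst (le_antisymm hle h')) (θ.symm h)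
  · exact key' hle h

end Below

/-- If `z` is not inside `D`, then joining with `z` fixes all elements inside `D` or sends them all to
one element, according as `z` is the least element of its layer or not. -/
theorem sup_inside {D : LowerSet I} {x y : Nest S I} (hx : Inside D x) (hy : Inside D y)
    (z : Nest S I) : z ⊔ x = z ⊔ y ∨ Inside D (z ⊔ x) ∧ Inside D (z ⊔ y) := by
  change Nest.sup _ _ = Nest.sup _ _ ∨ Inside D (Nest.sup _ _) ∧ Inside D (Nest.sup _ _)
  have hD : ∀ i j, i ≤ j → j ∈ D → i ∈ D := fun i j hij hj => D.lower hij hj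
  cases x <;> cases y <;> cases z <;> simp only [Nest.sup] <;> (try split_ifs) <;>
    simp_all [Inside]
  all_goals grind

theorem inf_inside {D : LowerSet I} {x y : Nest S I} (hx : Inside D x) (hy : Inside D y)
    (z : Nest S I) : z ⊓ x = z ⊓ y ∨ Inside D (z ⊓ x) ∧ Inside D (z ⊓ y) := by
  change Nest.inf _ _ = Nest.inf _ _ ∨ Inside D (Nest.inf _ _) ∧ Inside D (Nest.inf _ _)
  have hD : ∀ i j, i ≤ j → j ∈ D → i ∈ D := fun i j hij hj => D.lower hij hj
  cases x <;> cases y <;> cases z <;> simp only [Nest.inf] <;> (try split_ifs) <;>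
    simp_all [Inside]
  all_goals grind

variable (S) in
/-- The congruence whose only nontrivial class consists of the core and the layers in `D`. -/
def blockCon (D : LowerSet I) : LatticeCon (Nest S I) :=
  have trans : ∀ {x y z : Nest S I}, x = y ∨ Inside D x ∧ Inside D y →
      y = z ∨ Inside D y ∧ Inside D z → x = z ∨ Inside D x ∧ Inside D z := by
    rintro x y z (rfl | hx) (rfl | hz)
    exacts [.inl rfl, .inr hz, .inr hx, .inr ⟨hx.1, hz.2⟩]
  { r := fun x y => x = y ∨ Inside D x ∧ Inside D y
    iseqv := ⟨fun _ => .inl rfl, fun h => h.imp Eq.symm And.symm, trans⟩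
    inf := by
      have key : ∀ {x y : Nest S I}, x = y ∨ Inside D x ∧ Inside D y → ∀ z,
          z ⊓ x = z ⊓ y ∨ Inside D (z ⊓ x) ∧ Inside D (z ⊓ y) := by
        rintro x y (rfl | h) z
        exacts [.inl rfl, inf_inside h.1 h.2 z]
      intro w x y z h₁ h₂
      have h₃ := key h₁ y
      rw [inf_comm y, inf_comm y] at h₃
      exact trans h₃ (key h₂ x)
    sup := by
      have key : ∀ {x y : Nest S I}, x = y ∨ Inside D x ∧ Inside D y → ∀ z,
          z ⊔ x = z ⊔ y ∨ Inside D (z ⊔ x) ∧ Inside D (z ⊔ y) := by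
        rintro x y (rfl | h) z
        exacts [.inl rfl, sup_inside h.1 h.2 z]
      intro w x y z h₁ h₂
      have h₃ := key h₁ y
      rw [sup_comm y, sup_comm y] at h₃
      exact trans h₃ (key h₂ x) }

theorem blockCon_r {D : LowerSet I} {x y : Nest S I} :
    (blockCon S D).r x y ↔ x = y ∨ Inside D x ∧ Inside D y := Iff.rfl

/-- The layers whose least and greatest elements are identified by a congruence. -/
def collapsed (θ : LatticeCon (Nest S I)) : LowerSet I where
  carrier := {i | θ.r (layer i ⊥) (layer i ⊤)}
  lower' i j hij h := by
    rcases hij.eq_or_lt with rfl | hij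
    · exact h
    · exact r_of_mem_Icc h
        ⟨Below.layer_bot_le (x := layer j ⊥) hij, Below.le_layer_top (x := layer j ⊥) hij⟩
        ⟨Below.layer_bot_le (x := layer j ⊤) hij, Below.le_layer_top (x := layer j ⊤) hij⟩

/-- Two elements identified by a congruence are equal or both belong to the core and the layers
collapsed by the congruence. -/
theorem eq_or_inside [Nonempty S] {θ : LatticeCon (Nest S I)} {x y : Nest S I} (h : θ.r x y) :
    x = y ∨ Inside (collapsed θ) x ∧ Inside (collapsed θ) y := by
  by_cases hxy : x = y
  · exact .inl hxy
  refine .inr ?_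
  rcases x with a | ⟨i, s⟩ <;> rcases y with b | ⟨j, t⟩
  · exact ⟨trivial, trivial⟩
  · exact ⟨trivial, Below.collapse (x := core a) trivial (θ.symm h)⟩
  · exact ⟨Below.collapse (x := core b) trivial h, trivial⟩
  · rcases lt_trichotomy i j with hij | rfl | hij
    · have hj : j ∈ collapsed θ := Below.collapse (x := layer i s) hij (θ.symm h)
      exact ⟨(collapsed θ).lower hij.le hj, hj⟩
    · have hi : i ∈ collapsed θ := collapse_of_ne (fun e => hxy (congrArg _ e)) h
      exact ⟨hi, hi⟩
    · have hi : i ∈ collapsed θ := Below.collapse (x := layer j t) hij h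
      exact ⟨hi, (collapsed θ).lower hij.le hi⟩

/-- Over a simple core, every congruence that is not the equality collapses the core. -/
theorem eq_blockCon (hS : IsSimple S) {θ : LatticeCon (Nest S I)} (hθ : θ ≠ eqCon (Nest S I)) :
    θ = blockCon S (collapsed θ) := by
  have := hS.1
  have hcore : ∀ a b : S, θ.r (core a) (core b) := by
    obtain ⟨x, y, hxy, hne⟩ : ∃ x y, θ.r x y ∧ x ≠ y := by
      by_contra! hcon
      exact hθ (latticeCon_ext fun x y => ⟨hcon x y, fun h => eqCon_r.1 h ▸ θ.refl x⟩)
    have hlayer : ∀ i ∈ collapsed θ, ∀ a b : S, θ.r (core a) (core b) := fun i hi a b =>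
      r_of_mem_Icc hi ⟨Below.layer_bot_le (x := core a) trivial,
        Below.le_layer_top (x := core a) trivial⟩
        ⟨Below.layer_bot_le (x := core b) trivial, Below.le_layer_top (x := core b) trivial⟩
    obtain ⟨hx, hy⟩ := (eq_or_inside hxy).resolve_left hne
    rcases x with a | ⟨i, s⟩
    · rcases y with b | ⟨j, t⟩
      · refine (hS.2 (comapCon (coreHom S I) θ)).resolve_left fun h => hne ?_
        rw [h a b hxy]
      · exact hlayer j hy
    · exact hlayer i hx
  obtain ⟨a⟩ : Nonempty S := inferInstance
  have hin : ∀ x, Inside (collapsed θ) x → θ.r x (core a) := by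
    rintro (b | ⟨i, s⟩) hx
    · exact hcore b a
    · refine r_of_mem_Icc (a := layer i ⊥) (b := layer i ⊤) hx ⟨?_, ?_⟩
        ⟨Below.layer_bot_le (x := core a) trivial, Below.le_layer_top (x := core a) trivial⟩
      · rw [← sup_eq_right, layer_sup_layer, bot_sup_eq]
      · rw [← sup_eq_right, layer_sup_layer, sup_top_eq]
  refine latticeCon_ext fun x y => ⟨eq_or_inside, ?_⟩
  rintro (rfl | ⟨hx, hy⟩)
  · exact θ.refl x
  · exact θ.trans (hin x hx) (θ.symm (hin y hy))

theorem mk_latticeCon (hS : IsSimple S) :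
    #(LatticeCon (Nest S I)) = #(LowerSet I) + 1 := by
  rw [← mk_option]
  have := hS.1
  refine (mk_congr (Equiv.ofBijective
    (fun o : Option (LowerSet I) => o.elim (eqCon (Nest S I)) (blockCon S)) ⟨?_, ?_⟩)).symm
  · have hne : ∀ D : LowerSet I, eqCon (Nest S I) ≠ blockCon S D := fun D h => by
      obtain ⟨a, b, hab⟩ := exists_pair_ne S
      have h' : (blockCon S D).r (core a) (core b) := .inr ⟨trivial, trivial⟩
      rw [← h] at h'
      exact hab (core.inj h')
    rintro (_ | D) (_ | E) h
    · rfl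
    · exact (hne E h).elim
    · exact (hne D h.symm).elim
    · have key : ∀ (D : LowerSet I) i,
          (blockCon S D).r (layer i ⊥) (layer i ⊤) ↔ i ∈ D := fun D i => by
        rw [blockCon_r]
        simp [Inside]
      refine congrArg some (LowerSet.ext (Set.ext fun i => ?_))
      have h : blockCon S D = blockCon S E := h
      exact (key D i).symm.trans ((by rw [h]) : _ ↔ _) |>.trans (key E i)
  · intro θ
    by_cases hθ : θ = eqCon (Nest S I)
    · exact ⟨none, hθ.symm⟩
    · exact ⟨some (collapsed θ), (eq_blockCon hS hθ).symm⟩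

/-- A proper lower set of a well-order is an initial segment `Iio i`. -/
theorem mk_lowerSet (I : Type u) [LinearOrder I] [WellFoundedLT I] : #(LowerSet I) = #I + 1 := by
  rw [← mk_option]
  refine (mk_congr (Equiv.ofBijective
    (fun o : Option I => o.elim ⊤ LowerSet.Iio) ⟨?_, ?_⟩)).symm
  · have hne : ∀ i : I, (⊤ : LowerSet I) ≠ LowerSet.Iio i := fun i h =>
      lt_irrefl i (LowerSet.mem_Iio_iff.1 (h ▸ LowerSet.mem_top))
    rintro (_ | i) (_ | j) h
    · rfl
    · exact (hne j h).elim
    · exact (hne i h.symm).elim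
    · have h : LowerSet.Iio i = LowerSet.Iio j := h
      refine congrArg some (le_antisymm (not_lt.1 fun hlt => ?_) (not_lt.1 fun hlt => ?_))
      · exact lt_irrefl j (LowerSet.mem_Iio_iff.1 (h ▸ LowerSet.mem_Iio_iff.2 hlt))
      · exact lt_irrefl i (LowerSet.mem_Iio_iff.1 (h ▸ LowerSet.mem_Iio_iff.2 hlt))
  · intro D
    by_cases hD : D = ⊤
    · exact ⟨none, hD.symm⟩
    · obtain ⟨i, hi, hmin⟩ := wellFounded_lt.has_min ((D : Set I)ᶜ)
        (Set.nonempty_compl.2 fun h => hD (LowerSet.ext h))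
      refine ⟨some i, LowerSet.ext (Set.ext fun j => ⟨fun hj => ?_, fun hj => ?_⟩)⟩
      · by_contra hjD
        exact hmin j hjD (LowerSet.mem_Iio_iff.1 hj)
      · exact LowerSet.mem_Iio_iff.2 (not_le.1 fun hij => hi (D.lower hij hj))

section Filters

/-- The layers whose least element belongs to a filter. -/
def bottoms (F : Order.PFilter (Nest S I)) : LowerSet I where
  carrier := {i | layer i ⊥ ∈ F}
  lower' i j hij h := F.mem_of_le (le_def.2 (by
    rcases hij.eq_or_lt with rfl | hij
    · exact .inr (.inr ⟨rfl, le_rfl⟩)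
    · exact .inr (.inl ⟨hij, rfl⟩))) h

/-- A filter containing the least element of some layer contains the core and is determined by its
set of bottoms. -/
theorem mem_iff_of_layer_bot_mem {F : Order.PFilter (Nest S I)} {i : I} (hi : layer i ⊥ ∈ F) :
    ∀ x, x ∈ F ↔ match x with
      | core _ => True
      | layer j t => t = ⊤ ∨ j ∈ bottoms F
  | core a => iff_of_true (F.mem_of_le (Below.layer_bot_le (x := core a) trivial) hi) trivial
  | layer j t => by
    refine ⟨fun h => or_iff_not_imp_left.2 fun ht => ?_, ?_⟩
    · rcases le_or_gt j i with hji | hij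
      · exact (bottoms F).lower hji hi
      · have := Order.PFilter.inf_mem h hi
        rwa [Below.layer_inf (x := layer i ⊥) hij ht] at this
    · rintro (rfl | hj)
      · refine F.mem_of_le (le_def.2 ?_) hi
        rcases lt_trichotomy i j with hij | hij | hij
        · exact .inl ⟨hij, rfl⟩
        · exact .inr (.inr ⟨hij, bot_le⟩)
        · exact .inr (.inl ⟨hij, rfl⟩)
      · exact F.mem_of_le (x := layer j ⊥) (le_def.2 (.inr (.inr ⟨rfl, bot_le⟩))) hj

variable [WellFoundedLT S] [WellFoundedLT I]

/-- The least elements of the layers are the only obstacle to well-foundedness, so a filter avoiding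
them is principal. -/
theorem exists_eq_principal {F : Order.PFilter (Nest S I)} (hF : ∀ i, layer i ⊥ ∉ F) :
    ∃ x, F = Order.PFilter.principal x := by
  by_cases hcore : ∃ a, core a ∈ F
  · obtain ⟨a, ha, hmin⟩ := wellFounded_lt.has_min {a : S | core a ∈ F} hcore
    refine ⟨core a, eq_principal_of_minimal ha fun y hy hlt => ?_⟩
    have hle := le_def.1 hlt.le
    rcases y with b | ⟨i, s⟩
    · exact hmin b hy (lt_of_le_of_ne hle fun e => hlt.ne (e ▸ rfl))
    · have hs : s = ⊥ := hle
      exact hF i (hs ▸ hy)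
  · obtain ⟨x, hx⟩ := F.nonempty
    have hlayer : {i : I | ∃ s, layer i s ∈ F}.Nonempty := by
      rcases x with a | ⟨i, s⟩
      exacts [(hcore ⟨a, hx⟩).elim, ⟨i, s, hx⟩]
    obtain ⟨i, hi, hmin⟩ := wellFounded_lt.has_min _ hlayer
    obtain ⟨s, hs, hsmin⟩ := wellFounded_lt.has_min {s : Bool × Bool | layer i s ∈ F} hi
    refine ⟨layer i s, eq_principal_of_minimal hs fun y hy hlt => ?_⟩
    have hle := le_def.1 hlt.le
    rcases y with b | ⟨j, t⟩
    · exact hcore ⟨b, hy⟩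
    · rcases hle with ⟨hji, _⟩ | ⟨_, rfl⟩ | ⟨rfl, hts⟩
      · exact hmin j ⟨t, hy⟩ hji
      · exact hF j hy
      · exact hsmin t hy (lt_of_le_of_ne hts fun e => hlt.ne (e ▸ rfl))

theorem mk_pfilter_le : #(Order.PFilter (Nest S I)) ≤ #(Nest S I) + #(LowerSet I) := by
  have hunion : (Set.univ : Set (Order.PFilter (Nest S I))) ⊆
      Set.range Order.PFilter.principal ∪ {F | ∃ i, layer i ⊥ ∈ F} := fun F _ => by
    by_cases h : ∃ i, layer i ⊥ ∈ F
    · exact .inr h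
    · obtain ⟨x, hx⟩ := exists_eq_principal (not_exists.1 h)
      exact .inl ⟨x, hx.symm⟩
  rw [← mk_univ]
  refine (mk_le_mk_of_subset hunion).trans ((mk_union_le _ _).trans
    (add_le_add mk_range_le (mk_le_of_injective (f := fun F => bottoms F.1) ?_)))
  rintro ⟨F, i, hi⟩ ⟨G, j, hj⟩ h
  have h : bottoms F = bottoms G := h
  refine Subtype.ext (Order.PFilter.ext _ _ (Set.ext fun x => ?_))
  rw [SetLike.mem_coe, SetLike.mem_coe, mem_iff_of_layer_bot_mem hi, mem_iff_of_layer_bot_mem hj, h]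

end Filters

theorem mk_eq (S I : Type u) : #(Nest S I) = #S + #I * 4 := by
  let e : Nest S I ≃ S ⊕ I × ULift.{u} (Bool × Bool) :=
    { toFun := fun x => match x with
        | core a => .inl a
        | layer i s => .inr (i, ⟨s⟩)
      invFun := fun x => match x with
        | .inl a => core a
        | .inr (i, ⟨s⟩) => layer i s
      left_inv := by rintro (_ | _) <;> rfl
      right_inv := by rintro (_ | ⟨_, ⟨_⟩⟩) <;> rfl }
  rw [mk_congr e, ← add_def, ← mul_def]
  simp

/-- Nested lattices over a simple well-founded core have as many filters and ideals as the core,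
provided that there are not too many layers. -/
theorem isRepresentedBy {κ c : Cardinal.{u}} (hκ : ℵ₀ ≤ κ) (hS : IsSimple S) [WellFoundedLT S]
    [WellFoundedLT I] (hcard : #S = κ) (hid : #(Order.Ideal S) = 2 ^ κ) (hI : #I + 2 = c)
    (hc : c ≤ κ) : IsRepresentedBy c κ (2 ^ κ) (Nest S I) := by
  have hIκ : #I ≤ κ := (self_le_add_right _ _).trans (hI.le.trans hc)
  have hmk : #(Nest S I) = κ := by
    refine le_antisymm ?_ ?_
    · rw [mk_eq, hcard]
      refine add_le_of_le hκ le_rfl (mul_le_of_le hκ hIκ ?_)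
      exact (natCast_lt_aleph0 (n := 4)).le.trans hκ
    · rw [mk_eq, hcard]
      exact self_le_add_right _ _
  refine ⟨?_, le_antisymm ?_ ?_, le_antisymm ?_ ?_⟩
  · rw [mk_latticeCon hS, mk_lowerSet, ← hI, add_assoc, one_add_one_eq_two]
  · refine mk_pfilter_le.trans ?_
    rw [hmk, mk_lowerSet]
    exact add_le_of_le hκ le_rfl (add_le_of_le hκ hIκ (one_le_aleph0.trans hκ))
  · exact hmk.ge.trans (mk_le_mk_pfilter _)
  · exact (mk_ideal_le _).trans (by rw [hmk])
  · rw [← hid]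
    exact mk_ideal_le_of_embedding (embeddingOfHom (coreHom S I) fun a b h => core.inj h)

end Nest

/-! ### Lattices of finite-dimensional subspaces -/

section Subspaces

variable {K : Type v} {V : Type w} [Field K] [AddCommGroup V] [Module K V]

theorem mem_finDim {W : Submodule K V} : W ∈ finDim K V ↔ FiniteDimensional K W := Iff.rfl

theorem mem_finDim_of_le {W X : Submodule K V} (hX : X ∈ finDim K V) (h : W ≤ X) :
    W ∈ finDim K V := by
  rw [mem_finDim] at *
  exact Submodule.finiteDimensional_of_le h

theorem span_mem_finDim (v : V) : Submodule.span K {v} ∈ finDim K V :=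
  mem_finDim.2 inferInstance

variable (K V) in
/-- Complements in the complemented modular lattice of all subspaces, moved into an interval. -/
theorem finDim_isRelativelyComplemented : IsRelativelyComplemented (finDim K V) := by
  rintro ⟨a, ha⟩ ⟨b, hb⟩ ⟨x, hx⟩ hax hxb
  have hax : a ≤ x := hax
  have hxb : x ≤ b := hxb
  obtain ⟨y, hy⟩ := exists_isCompl x
  refine ⟨⟨(a ⊔ y) ⊓ b, mem_finDim_of_le hb inf_le_right⟩, Subtype.ext ?_, Subtype.ext ?_⟩
  · change x ⊓ ((a ⊔ y) ⊓ b) = a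
    rw [inf_comm (a ⊔ y), ← inf_assoc, inf_eq_left.2 hxb, inf_comm, sup_inf_assoc_of_le _ hax,
      inf_comm y, hy.inf_eq_bot, sup_bot_eq]
  · change x ⊔ ((a ⊔ y) ⊓ b) = b
    rw [← sup_inf_assoc_of_le _ hxb, sup_left_comm, hy.sup_eq_top, sup_top_eq, top_inf_eq]

/-- A line `W` lies in the join of any other line `Y` with a third one that meets `W` trivially, so
collapsing `Y` collapses `W`. -/
theorem r_bot_span {θ : LatticeCon (finDim K V)} {v : V}
    (hv : v ≠ 0) (h : θ.r ⊥ ⟨Submodule.span K {v}, span_mem_finDim v⟩) (w : V) :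
    θ.r ⊥ ⟨Submodule.span K {w}, span_mem_finDim w⟩ := by
  by_cases hw : w ∈ Submodule.span K {v}
  · refine r_of_mem_Icc h ⟨bot_le, bot_le⟩ ⟨bot_le, ?_⟩
    exact (Submodule.span_singleton_le_iff_mem w _).2 hw
  let W : finDim K V := ⟨Submodule.span K {w}, span_mem_finDim w⟩
  let Y : finDim K V := ⟨Submodule.span K {v}, span_mem_finDim v⟩
  let Z : finDim K V := ⟨Submodule.span K {w - v}, span_mem_finDim (w - v)⟩
  have h₁ : W ⊓ (Z ⊔ Y) = W := by
    refine inf_eq_left.2 ((Submodule.span_singleton_le_iff_mem w _).2 ?_)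
    exact Submodule.mem_sup.2 ⟨_, Submodule.mem_span_singleton_self _, _,
      Submodule.mem_span_singleton_self _, sub_add_cancel w v⟩
  have h₂ : W ⊓ (Z ⊔ ⊥) = ⊥ := by
    rw [sup_bot_eq]
    refine Subtype.ext ((Submodule.eq_bot_iff _).2 ?_)
    rintro x ⟨hx₁, hx₂⟩
    obtain ⟨c, rfl⟩ := Submodule.mem_span_singleton.1 hx₁
    obtain ⟨d, hd⟩ := Submodule.mem_span_singleton.1 hx₂
    by_cases hdc : d = c
    · subst hdc
      have : d • v = 0 := by
        rw [smul_sub] at hd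
        exact sub_eq_self.1 hd
      rcases smul_eq_zero.1 this with h0 | h0
      · rw [h0, zero_smul]
      · exact (hv h0).elim
    · refine (hw (Submodule.mem_span_singleton.2 ⟨(d - c)⁻¹ * d, ?_⟩)).elim
      have hd' : d • v = (d - c) • w := by
        rw [sub_smul, ← hd, smul_sub]
        abel
      rw [mul_smul, hd', smul_smul, inv_mul_cancel₀ (sub_ne_zero.2 hdc), one_smul]
  have := r_inf_left (r_sup_left h Z) W
  change θ.r (W ⊓ (Z ⊔ ⊥)) (W ⊓ (Z ⊔ Y)) at this
  rwa [h₁, h₂] at this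

theorem r_bot_of_line {θ : LatticeCon (finDim K V)} {v : V}
    (hv : v ≠ 0) (h : θ.r ⊥ ⟨Submodule.span K {v}, span_mem_finDim v⟩) (W : finDim K V) :
    θ.r ⊥ W := by
  obtain ⟨W, hW⟩ := W
  have key : ∀ X : Submodule K V, X.FG → ∃ hX : X ∈ finDim K V, θ.r ⊥ ⟨X, hX⟩ := fun X hX => by
    refine Submodule.fg_induction (motive := fun X _ => ∃ hX : X ∈ finDim K V, θ.r ⊥ ⟨X, hX⟩)
      (fun w => ⟨span_mem_finDim w, r_bot_span hv h w⟩) ?_ X hX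
    rintro X Y _ _ ⟨hX, hX'⟩ ⟨hY, hY'⟩
    refine ⟨(finDim K V).supClosed hX hY, ?_⟩
    have := θ.sup hX' hY'
    rwa [sup_bot_eq] at this
  exact (key W ((Submodule.fg_iff_finiteDimensional _).2 hW)).2

theorem r_bot_of_ne_bot {θ : LatticeCon (finDim K V)} {X : finDim K V} (hX : X ≠ ⊥)
    (h : θ.r ⊥ X) (W : finDim K V) : θ.r ⊥ W := by
  obtain ⟨v, hvX, hv⟩ := Submodule.exists_mem_ne_zero_of_ne_bot fun e => hX (Subtype.ext e)
  exact r_bot_of_line hv (r_of_mem_Icc h ⟨bot_le, bot_le⟩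
    ⟨bot_le, (Submodule.span_singleton_le_iff_mem v _).2 hvX⟩) W

variable (K V) in
theorem finDim_isSimple [Nontrivial V] : IsSimple (finDim K V) := by
  refine ⟨?_, fun θ => or_iff_not_imp_left.2 fun h => ?_⟩
  · obtain ⟨v, hv⟩ := exists_ne (0 : V)
    refine ⟨⊥, ⟨_, span_mem_finDim v⟩, fun h => hv ?_⟩
    exact Submodule.span_singleton_eq_bot.1 (congrArg Subtype.val h).symm
  · push Not at h
    obtain ⟨x, y, hxy, hne⟩ := h
    -- A complement of `x ⊓ y` in `[⊥, x ⊔ y]` is a nonzero subspace congruent to `⊥`.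
    have hle := (θ.r_inf_sup_iff).2 hxy
    obtain ⟨z, hz, hz'⟩ := finDim_isRelativelyComplemented K V ⊥ (x ⊔ y) (x ⊓ y) bot_le
      inf_le_sup
    have h₁ := r_inf_left hle z
    rw [inf_comm, hz, inf_eq_left.2 (hz' ▸ le_sup_right)] at h₁
    have hz0 : z ≠ ⊥ := by
      rintro rfl
      rw [sup_bot_eq] at hz'
      exact hne (inf_eq_sup.1 hz')
    exact fun a b => θ.trans (θ.symm (r_bot_of_ne_bot hz0 h₁ a)) (r_bot_of_ne_bot hz0 h₁ b)

instance : WellFoundedLT (finDim K V) := by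
  refine StrictMono.wellFoundedLT (f := fun W : finDim K V => Module.finrank K W.1) ?_
  rintro ⟨X, hX⟩ ⟨Y, hY⟩ h
  have : FiniteDimensional K Y := hY
  exact Submodule.finrank_lt_finrank_of_lt h

instance : WellFoundedLT (finDimTop K V) := by
  classical
  refine StrictMono.wellFoundedLT (f := fun W : finDimTop K V =>
    if W = ⊤ then (⊤ : WithTop ℕ) else (Module.finrank K W.1 : ℕ)) ?_
  rintro ⟨X, hX⟩ ⟨Y, hY⟩ h
  have hX' : (⟨X, hX⟩ : finDimTop K V) ≠ ⊤ := h.ne_top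
  simp only [hX', if_false]
  split_ifs with hYt
  · exact WithTop.coe_lt_top _
  · have : FiniteDimensional K Y := hY.resolve_right fun e => hYt (Subtype.ext e)
    exact WithTop.coe_lt_coe.2 (Submodule.finrank_lt_finrank_of_lt h)

variable (K V) in
/-- The inclusion of the lattice of finite-dimensional subspaces. -/
def finDimInclusion : LatticeHom (finDim K V) (finDimTop K V) where
  toFun W := ⟨W.1, .inl W.2⟩
  map_sup' _ _ := rfl
  map_inf' _ _ := rfl

theorem finDimInclusion_injective : Function.Injective (finDimInclusion K V) := fun _ _ h =>
  Subtype.ext (congrArg (fun x : finDimTop K V => x.1) h)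

theorem eq_top_or_eq_finDimInclusion (x : finDimTop K V) :
    x = ⊤ ∨ ∃ W, x = finDimInclusion K V W := by
  obtain ⟨x, hx | hx⟩ := x
  exacts [.inr ⟨⟨x, hx⟩, rfl⟩, .inl (Subtype.ext hx)]

theorem finDimInclusion_ne_top (hV : ¬ FiniteDimensional K V) (W : finDim K V) :
    finDimInclusion K V W ≠ ⊤ := fun h => by
  have hW := W.2
  have h : W.1 = ⊤ := congrArg Subtype.val h
  rw [mem_finDim, h] at hW
  exact hV (Module.Finite.equiv Submodule.topEquiv)

/-- The congruence of `finDimTop` with the two classes of finite-dimensional subspaces and of the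
whole space. -/
def topCon (hV : ¬ FiniteDimensional K V) : LatticeCon (finDimTop K V) where
  r x y := x = ⊤ ↔ y = ⊤
  iseqv := ⟨fun _ => Iff.rfl, Iff.symm, Iff.trans⟩
  inf {w x y z} h₁ h₂ := by rw [inf_eq_top_iff, inf_eq_top_iff, h₁, h₂]
  sup {w x y z} h₁ h₂ := by
    have key : ∀ x y : finDimTop K V, x ⊔ y = ⊤ ↔ x = ⊤ ∨ y = ⊤ := fun x y => by
      refine ⟨fun h => ?_, ?_⟩
      · by_contra! hxy
        obtain ⟨X, rfl⟩ := (eq_top_or_eq_finDimInclusion x).resolve_left hxy.1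
        obtain ⟨Y, rfl⟩ := (eq_top_or_eq_finDimInclusion y).resolve_left hxy.2
        exact finDimInclusion_ne_top hV _ ((map_sup _ X Y).trans h)
      · rintro (rfl | rfl) <;> simp
    rw [key, key, h₁, h₂]

/-- Identifying the whole space with a finite-dimensional subspace `X` collapses any line disjoint
from `X`, hence all finite-dimensional subspaces. -/
theorem eq_fullCon_of_r_top (hV : ¬ FiniteDimensional K V) {θ : LatticeCon (finDimTop K V)}
    {X : finDim K V} (h : θ.r (finDimInclusion K V X) ⊤) : θ = fullCon (finDimTop K V) := by
  have hX := X.2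
  rw [mem_finDim] at hX
  obtain ⟨v, hv⟩ : ∃ v, v ∉ X.1 := by
    by_contra! hcon
    exact finDimInclusion_ne_top hV X (Subtype.ext (Submodule.eq_top_iff'.2 hcon))
  let Y : finDim K V := ⟨_, span_mem_finDim v⟩
  have hY : Y ⊓ X = ⊥ := by
    refine Subtype.ext ((Submodule.eq_bot_iff _).2 ?_)
    rintro x ⟨hx₁, hx₂⟩
    obtain ⟨c, rfl⟩ := Submodule.mem_span_singleton.1 hx₁
    by_contra hne
    have hc : c ≠ 0 := by rintro rfl; exact hne (zero_smul K v)
    exact hv ((Submodule.smul_mem_iff _ hc).1 hx₂)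
  have hv0 : v ≠ 0 := by rintro rfl; exact hv (zero_mem _)
  have h₁ := r_inf_left h (finDimInclusion K V Y)
  rw [← map_inf, hY, inf_top_eq] at h₁
  have key := r_bot_of_line (θ := comapCon (finDimInclusion K V) θ) hv0 h₁
  have hall : ∀ x, θ.r (finDimInclusion K V ⊥) x := fun x => by
    rcases eq_top_or_eq_finDimInclusion x with rfl | ⟨W, rfl⟩
    · exact θ.trans (key X) h
    · exact key W
  exact latticeCon_ext fun x y =>
    ⟨fun _ => fullCon_r x y, fun _ => θ.trans (θ.symm (hall x)) (hall y)⟩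

theorem card_latticeCon_finDimTop (hV : ¬ FiniteDimensional K V) :
    Nat.card (LatticeCon (finDimTop K V)) = 3 := by
  have hnt : Nontrivial V := by
    by_contra hn
    rw [not_nontrivial_iff_subsingleton] at hn
    exact hV inferInstance
  have hsimple := finDim_isSimple K V
  have hne : ∀ W, finDimInclusion K V W ≠ ⊤ := finDimInclusion_ne_top hV
  obtain ⟨X, Y, hXY⟩ := hsimple.1
  have hXY' : (topCon hV).r (finDimInclusion K V X) (finDimInclusion K V Y) :=
    iff_of_false (hne X) (hne Y)
  rw [← Set.ncard_univ, Set.ncard_eq_three]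
  refine ⟨eqCon _, topCon hV, fullCon _, fun h => ?_, fun h => ?_, fun h => ?_, ?_⟩
  · rw [← h, eqCon_r] at hXY'
    exact hXY (finDimInclusion_injective hXY')
  · have := fullCon_r (finDimInclusion K V X) (finDimInclusion K V Y)
    rw [← h, eqCon_r] at this
    exact hXY (finDimInclusion_injective this)
  · have := fullCon_r (finDimInclusion K V X) ⊤
    rw [← h] at this
    exact hne X ((show _ ↔ _ from this).2 rfl)
  · refine (Set.eq_univ_of_forall fun θ => ?_).symm
    by_cases htop : ∃ X, θ.r (finDimInclusion K V X) ⊤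
    · obtain ⟨X, hX⟩ := htop
      exact .inr (.inr (eq_fullCon_of_r_top hV hX))
    push Not at htop
    rcases hsimple.2 (comapCon (finDimInclusion K V) θ) with h | h
    · refine .inl (latticeCon_ext fun x y => ⟨fun hxy => ?_, fun e => eqCon_r.1 e ▸ θ.refl x⟩)
      rw [eqCon_r]
      rcases eq_top_or_eq_finDimInclusion x with rfl | ⟨W, rfl⟩ <;>
        rcases eq_top_or_eq_finDimInclusion y with rfl | ⟨Z, rfl⟩
      · rfl
      · exact (htop Z (θ.symm hxy)).elim
      · exact (htop W hxy).elim
      · rw [h W Z hxy]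
    · refine .inr (.inl (latticeCon_ext fun x y => ?_))
      change _ ↔ (x = ⊤ ↔ y = ⊤)
      rcases eq_top_or_eq_finDimInclusion x with rfl | ⟨W, rfl⟩ <;>
        rcases eq_top_or_eq_finDimInclusion y with rfl | ⟨Z, rfl⟩
      · exact iff_of_true (θ.refl _) Iff.rfl
      · exact iff_of_false (fun e => htop Z (θ.symm e)) (fun e => hne Z (e.1 rfl))
      · exact iff_of_false (htop W) (fun e => hne W (e.2 rfl))
      · exact iff_of_true (h W Z) (iff_of_false (hne W) (hne Z))

end Subspaces

/-! ### Cardinalities for the space of finitely supported functions -/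

section Cardinality

variable {K : Type} [Field K] {ι : Type u} [Infinite ι]

variable (K ι) in
theorem not_finiteDimensional_finsupp : ¬ FiniteDimensional K (ι →₀ K) := fun _ =>
  have : Finite ι := Module.Finite.finite_basis (Finsupp.basisSingleOne (R := K))
  not_finite ι

theorem mk_finDim [Countable K] : #(finDim K (ι →₀ K)) = #ι := by
  have hV : #(ι →₀ K) = #ι := by
    rw [mk_finsupp_lift_of_infinite, lift_uzero]
    exact max_eq_left ((lift_le_aleph0.2 mk_le_aleph0).trans (aleph0_le_mk ι))
  have hinf : Infinite (ι →₀ K) := infinite_iff.2 (hV ▸ aleph0_le_mk ι)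
  refine le_antisymm ?_ ?_
  · rw [← hV, ← mk_finset_of_infinite (ι →₀ K)]
    refine mk_le_of_surjective (f := fun s : Finset (ι →₀ K) =>
      (⟨Submodule.span K (s : Set (ι →₀ K)),
        mem_finDim.2 (FiniteDimensional.span_finset K s)⟩ : finDim K (ι →₀ K))) ?_
    rintro ⟨W, hW⟩
    obtain ⟨s, hs⟩ := (Submodule.fg_iff_finiteDimensional W).2 hW
    exact ⟨s, Subtype.ext hs⟩
  · refine mk_le_of_injective (f := fun i : ι =>
      (⟨_, span_mem_finDim (Finsupp.single i (1 : K))⟩ : finDim K (ι →₀ K))) fun i j h => ?_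
    have hij : Finsupp.single i (1 : K) ∈ Submodule.span K {Finsupp.single j (1 : K)} :=
      (congrArg Subtype.val h).le (Submodule.mem_span_singleton_self _)
    obtain ⟨c, hc⟩ := Submodule.mem_span_singleton.1 hij
    by_contra hne
    have := DFunLike.congr_fun hc i
    simp [Finsupp.single_eq_of_ne hne] at this

theorem mk_finDimTop_le [Countable K] : #(finDimTop K (ι →₀ K)) ≤ #ι := by
  have : #(Option (finDim K (ι →₀ K))) = #ι := by
    rw [mk_option, mk_finDim]
    exact add_one_eq (aleph0_le_mk ι)
  rw [← this]
  refine mk_le_of_surjective (f := fun o => o.elim ⊤ (finDimInclusion K (ι →₀ K))) fun x => ?_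
  rcases eq_top_or_eq_finDimInclusion x with rfl | ⟨W, rfl⟩
  exacts [⟨none, rfl⟩, ⟨some W, rfl⟩]

/-- The ideals consisting of the finite-dimensional subspaces supported in a set of basis vectors
are pairwise distinct. -/
theorem mk_ideal_finDim [Countable K] : #(Order.Ideal (finDim K (ι →₀ K))) = 2 ^ #ι := by
  refine le_antisymm ((mk_ideal_le _).trans_eq (by rw [mk_finDim])) ?_
  have hA : ∀ A : Set ι,
      Order.IsIdeal {W : finDim K (ι →₀ K) | W.1 ≤ Finsupp.supported K K A} := fun A =>
    ⟨fun X Y h hX => le_trans (show Y.1 ≤ X.1 from h) hX, ⟨⊥, show (⊥ : Submodule K (ι →₀ K)) ≤ _ from bot_le⟩,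
      fun X hX Y hY => ⟨X ⊔ Y, sup_le (α := Submodule K (ι →₀ K)) hX hY, le_sup_left, le_sup_right⟩⟩
  rw [← mk_set]
  refine mk_le_of_injective (f := fun A => (hA A).toIdeal) fun A B h => ?_
  have key : ∀ (A : Set ι) (i : ι),
      (⟨_, span_mem_finDim (Finsupp.single i (1 : K))⟩ : finDim K (ι →₀ K)) ∈ (hA A).toIdeal ↔
        i ∈ A := fun A i => by
    change Submodule.span K {Finsupp.single i (1 : K)} ≤ Finsupp.supported K K A ↔ _
    rw [Submodule.span_singleton_le_iff_mem, Finsupp.mem_supported,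
      Finsupp.support_single i (one_ne_zero (α := K))]
    simp
  have h : (hA A).toIdeal = (hA B).toIdeal := h
  exact Set.ext fun i => by rw [← key, h, key]

end Cardinality

/-! ### Lattice identities -/

section Identities

variable {L : Type u} {M : Type v} [Lattice L] [Lattice M]

theorem map_eval (f : LatticeHom L M) (a : ℕ → L) (t : LatticeTerm) :
    f (t.eval a) = t.eval fun i => f (a i) := by
  induction t with
  | var i => rfl
  | join s t hs ht => rw [LatticeTerm.eval, map_sup, hs, ht, LatticeTerm.eval]
  | meet s t hs ht => rw [LatticeTerm.eval, map_inf, hs, ht, LatticeTerm.eval]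

theorem eval_mono {a b : ℕ → L} (h : ∀ i, a i ≤ b i) (t : LatticeTerm) : t.eval a ≤ t.eval b := by
  induction t with
  | var i => exact h i
  | join s t hs ht => exact sup_le_sup hs ht
  | meet s t hs ht => exact inf_le_inf hs ht

theorem Satisfies.of_injective {s t : LatticeTerm} (h : Satisfies M s t) (f : LatticeHom L M)
    (hf : Function.Injective f) : Satisfies L s t := fun a => by
  apply hf
  rw [map_eval, map_eval, h]

theorem Satisfies.prod {s t : LatticeTerm} (hL : Satisfies L s t) (hM : Satisfies M s t) :
    Satisfies (L × M) s t := fun a => by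
  let f : LatticeHom (L × M) L := ⟨⟨Prod.fst, fun _ _ => rfl⟩, fun _ _ => rfl⟩
  let g : LatticeHom (L × M) M := ⟨⟨Prod.snd, fun _ _ => rfl⟩, fun _ _ => rfl⟩
  have h₁ := hL fun i => f (a i)
  have h₂ := hM fun i => g (a i)
  rw [← map_eval, ← map_eval] at h₁ h₂
  exact Prod.ext h₁ h₂

theorem Satisfies.set {s t : LatticeTerm} (h : Satisfies Prop s t) (ι : Type w) :
    Satisfies (Set ι) s t := fun a => by
  ext i
  let f : LatticeHom (Set ι) Prop :=
    { toFun := fun X => i ∈ X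
      map_sup' := fun _ _ => rfl
      map_inf' := fun _ _ => rfl }
  have := h fun j => f (a j)
  rw [← map_eval, ← map_eval] at this
  exact Iff.of_eq this

end Identities

/-! ### Congruences of vector spaces and subspaces -/

section Congruences

variable {K : Type v} {V : Type w} [Field K] [AddCommGroup V] [Module K V]

theorem moduleCon_ext {c d : ModuleCon K V} (h : ∀ x y, c.r x y ↔ d.r x y) : c = d :=
  toAddCon_injective (AddCon.ext h)

variable (K V) in
/-- The lattice of congruences of a vector space is the lattice of its subspaces. -/
def submoduleEquivModuleCon : Submodule K V ≃o ModuleCon K V where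
  toFun W :=
    { r := fun x y => x - y ∈ W
      iseqv := ⟨fun x => by rw [sub_self]; exact W.zero_mem,
        fun {x y} h => by rw [← neg_sub]; exact W.neg_mem h,
        fun {x y z} h₁ h₂ => by rw [← sub_add_sub_cancel x y z]; exact W.add_mem h₁ h₂⟩
      add' := fun {w x y z} h₁ h₂ => by
        rw [add_sub_add_comm]
        exact W.add_mem h₁ h₂
      smul := fun k {x y} h => by
        rw [← smul_sub]
        exact W.smul_mem k h }
  invFun c :=
    { carrier := {x | c.r x 0}
      zero_mem' := c.refl 0
      add_mem' := fun {x y} hx hy => by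
        have := c.add' hx hy
        rwa [add_zero] at this
      smul_mem' := fun k x hx => by
        have := c.smul k hx
        rwa [smul_zero] at this }
  left_inv W := by
    ext x
    change x - 0 ∈ W ↔ x ∈ W
    rw [sub_zero]
  right_inv c := by
    refine moduleCon_ext fun x y => ?_
    change c.r (x - y) 0 ↔ c.r x y
    refine ⟨fun h => ?_, fun h => ?_⟩
    · have := c.add' h (c.refl y)
      rwa [sub_add_cancel, zero_add] at this
    · have := c.add' h (c.refl (-y))
      rwa [← sub_eq_add_neg, add_neg_cancel] at this
  map_rel_iff' {W X} := by
    refine ⟨fun h x hx => ?_, fun h x y hxy => h hxy⟩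
    have h' := @h x 0 (show x - 0 ∈ W by rwa [sub_zero])
    change x - 0 ∈ X at h'
    rwa [sub_zero] at h'

/-- An element of the value of a lattice term lies in the value of the same term at the
intersections of the given subspaces with a finite-dimensional subspace. -/
theorem exists_mem_eval (a : ℕ → Submodule K V) (t : LatticeTerm) {x : V} (hx : x ∈ t.eval a) :
    ∃ D : Submodule K V, FiniteDimensional K D ∧ x ∈ t.eval fun i => a i ⊓ D := by
  have mono : ∀ {D E : Submodule K V} (t : LatticeTerm), D ≤ E →
      t.eval (fun i => a i ⊓ D) ≤ t.eval fun i => a i ⊓ E := fun t h =>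
    eval_mono (fun i => inf_le_inf_left _ h) t
  induction t generalizing x with
  | var i =>
    exact ⟨Submodule.span K {x}, inferInstance, hx, Submodule.mem_span_singleton_self x⟩
  | join s t hs ht =>
    obtain ⟨y, hy, z, hz, rfl⟩ := Submodule.mem_sup.1 hx
    obtain ⟨D, hD, hyD⟩ := hs hy
    obtain ⟨E, hE, hzE⟩ := ht hz
    exact ⟨D ⊔ E, inferInstance, Submodule.add_mem_sup (mono s le_sup_left hyD)
      (mono t le_sup_right hzE)⟩
  | meet s t hs ht =>
    obtain ⟨D, hD, hyD⟩ := hs hx.1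
    obtain ⟨E, hE, hzE⟩ := ht hx.2
    exact ⟨D ⊔ E, inferInstance, mono s le_sup_left hyD, mono t le_sup_right hzE⟩

/-- The lattice homomorphism between subspace lattices induced by an injective linear map. -/
def mapHom {W : Type u} [AddCommGroup W] [Module K W] (f : V →ₗ[K] W) (hf : Function.Injective f) :
    LatticeHom (Submodule K V) (Submodule K W) where
  toFun := Submodule.map f
  map_sup' _ _ := Submodule.map_sup _ _ f
  map_inf' _ _ := Submodule.map_inf f hf

/-- A lattice identity that holds in the lattice of finite-dimensional subspaces of an
infinite-dimensional vector space holds in the subspace lattice of every vector space over the same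
field, since it can be tested on finite-dimensional vector spaces. -/
theorem Satisfies.submodule {s t : LatticeTerm} (hV : ¬ FiniteDimensional K V)
    (h : Satisfies (finDim K V) s t) (W : Type w) [AddCommGroup W] [Module K W] :
    Satisfies (Submodule K W) s t := by
  have hD : ∀ (D : Submodule K W), FiniteDimensional K D → Satisfies (Submodule K D) s t :=
    fun D hD => by
      obtain ⟨f, hf⟩ := Module.Free.exists_linearMap_injective_of_rank_lt (R := K) (M := D) (N := V)
        ((Module.rank_lt_aleph0 K D).trans_le
          (not_lt.1 fun hlt => hV (Module.rank_lt_aleph0_iff.1 hlt)))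
      let g : LatticeHom (Submodule K D) (finDim K V) :=
        { toFun := fun X => ⟨X.map f, mem_finDim.2 inferInstance⟩
          map_sup' := fun X Y => Subtype.ext (map_sup (mapHom f hf) X Y)
          map_inf' := fun X Y => Subtype.ext (map_inf (mapHom f hf) X Y) }
      exact h.of_injective g fun X Y hXY =>
        Submodule.map_injective_of_injective hf (congrArg (fun Z : finDim K V => Z.1) hXY)
  have key : ∀ (a : ℕ → Submodule K W) (D : Submodule K W), FiniteDimensional K D →
      s.eval (fun i => a i ⊓ D) = t.eval fun i => a i ⊓ D := fun a D hfin => by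
    have ha : (fun i => a i ⊓ D) =
        fun i => mapHom D.subtype D.injective_subtype ((a i).comap D.subtype) := by
      funext i
      rw [inf_comm]
      exact (Submodule.map_comap_subtype D (a i)).symm
    rw [ha, ← map_eval, ← map_eval, hD D hfin]
  refine fun a => le_antisymm (fun x hx => ?_) (fun x hx => ?_)
  · obtain ⟨D, hfin, hxD⟩ := exists_mem_eval a s hx
    rw [key a D hfin] at hxD
    exact eval_mono (b := a) (fun i => inf_le_left) t hxD
  · obtain ⟨D, hfin, hxD⟩ := exists_mem_eval a t hx
    rw [← key a D hfin] at hxD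
    exact eval_mono (b := a) (fun i => inf_le_left) s hxD

/-- The two-element lattice is a sublattice of the lattice of finite-dimensional subspaces. -/
theorem Satisfies.prop {s t : LatticeTerm} [Nontrivial V] (h : Satisfies (finDim K V) s t) :
    Satisfies Prop s t := by
  classical
  obtain ⟨v, hv⟩ := exists_ne (0 : V)
  let W : finDim K V := ⟨_, span_mem_finDim v⟩
  let f : LatticeHom Prop (finDim K V) :=
    { toFun := fun P => if P then W else ⊥
      map_sup' := fun P Q => by by_cases hP : P <;> by_cases hQ : Q <;> simp [hP, hQ]
      map_inf' := fun P Q => by by_cases hP : P <;> by_cases hQ : Q <;> simp [hP, hQ] }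
  refine h.of_injective f fun P Q hPQ => ?_
  have hW : W ≠ ⊥ := fun e => hv (Submodule.span_singleton_eq_bot.1 (congrArg Subtype.val e))
  have hPQ : (if P then W else ⊥) = if Q then W else ⊥ := hPQ
  by_cases hP : P <;> by_cases hQ : Q <;> simp_all

end Congruences

/-! ### The towers -/

section Modular

theorem subtype_satisfies {L : Type u} [Lattice L] (S : Sublattice L) {s t : LatticeTerm}
    (h : Satisfies L s t) : Satisfies S s t :=
  h.of_injective S.subtype Subtype.val_injective

/-- The left-hand side of the modular law, written as an identity. -/
def modularLeft : LatticeTerm :=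
  .meet (.join (.meet (.var 0) (.var 2)) (.var 1)) (.var 2)

/-- The right-hand side of the modular law, written as an identity. -/
def modularRight : LatticeTerm :=
  .join (.meet (.var 0) (.var 2)) (.meet (.var 1) (.var 2))

theorem satisfies_modular (L : Type u) [Lattice L] [IsModularLattice L] :
    Satisfies L modularLeft modularRight := fun _ => sup_inf_assoc_of_le _ inf_le_right

theorem isModularLattice_of_satisfies {L : Type u} [Lattice L]
    (h : Satisfies L modularLeft modularRight) : IsModularLattice L where
  sup_inf_le_assoc_of_le := fun {x} y {z} hxz => by
    have h' : (x ⊓ z ⊔ y) ⊓ z = x ⊓ z ⊔ y ⊓ z :=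
      h fun i => match i with
        | 0 => x
        | 1 => y
        | _ => z
    rw [inf_eq_left.2 hxz] at h'
    exact h'.le

end Modular

instance (A : Type v) (B : Type w) [Lattice A] [OrderTop A] [Lattice B] [OrderBot B]
    [WellFoundedLT A] [WellFoundedLT B] : WellFoundedLT (gluedSum A B) :=
  StrictMono.wellFoundedLT (f := fun x : gluedSum A B => x.1) fun _ _ h => h

/-- The properties of a lattice `L` built from `E` and similar lattices by glued sums that are
inherited by further glued sums and determine the numbers of congruences, filters and ideals of `L`
and the variety generated by `L`. -/
structure IsTowerOver (E : Type u) [Lattice E] (N : ℕ) (L : Type u) [Lattice L] : Prop where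
  wellFoundedLT : WellFoundedLT L
  mk_le : #L ≤ #E
  card_con : Nat.card (LatticeCon L) = N
  satisfies : ∀ s t, Satisfies E s t → Satisfies L s t
  exists_hom : ∃ f : LatticeHom E L, Function.Injective f

section Tower

variable {E L : Type u} [Lattice E] [Lattice L] {N : ℕ}

theorem IsTowerOver.isModularLattice (h : IsTowerOver E N L) [IsModularLattice E] :
    IsModularLattice L :=
  isModularLattice_of_satisfies (h.satisfies _ _ (satisfies_modular E))

theorem IsTowerOver.satisfies_iff (h : IsTowerOver E N L) (s t : LatticeTerm) :
    Satisfies L s t ↔ Satisfies E s t := by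
  obtain ⟨f, hf⟩ := h.exists_hom
  exact ⟨fun hL => hL.of_injective f hf, h.satisfies s t⟩

theorem IsTowerOver.isRepresentedBy (h : IsTowerOver E N L) (hN : N ≠ 0)
    (hE : #(Order.Ideal E) = 2 ^ #E) : IsRepresentedBy (N : Cardinal.{u}) #E (2 ^ #E) L := by
  have := h.wellFoundedLT
  obtain ⟨f, hf⟩ := h.exists_hom
  have hmk : #L = #E := le_antisymm h.mk_le (mk_le_of_injective hf)
  refine ⟨?_, (mk_pfilter L).trans hmk, le_antisymm ((mk_ideal_le L).trans_eq (by rw [hmk])) ?_⟩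
  · have : Finite (LatticeCon L) := Nat.finite_of_card_ne_zero (by rwa [h.card_con])
    rw [← Nat.cast_card, h.card_con]
  · rw [← hE]
    exact mk_ideal_le_of_embedding (embeddingOfHom f hf)

theorem IsTowerOver.gluedSum {A : Type u} [Lattice A] [OrderTop A] [OrderBot L] {k : ℕ}
    (hA : IsTowerOver E k A) (hL : IsTowerOver E N L) (hE : ℵ₀ ≤ #E) :
    IsTowerOver E (k * N) (gluedSum A L) where
  wellFoundedLT :=
    have := hA.wellFoundedLT
    have := hL.wellFoundedLT
    inferInstance
  mk_le := (mk_le_of_injective Subtype.val_injective).trans (by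
    rw [← mul_def]
    exact mul_le_of_le hE hA.mk_le hL.mk_le)
  card_con := by rw [card_latticeCon_gluedSum, hA.card_con, hL.card_con]
  satisfies s t h := subtype_satisfies _ ((hA.satisfies s t h).prod (hL.satisfies s t h))
  exists_hom := by
    obtain ⟨f, hf⟩ := hL.exists_hom
    exact ⟨(gluedInr A L).comp f, (gluedInr_injective A L).comp hf⟩

end Tower

variable {K : Type} [Field K] {ι : Type u} [Infinite ι]

variable (K ι) in
theorem isTowerOver_finDim :
    IsTowerOver (finDim K (ι →₀ K)) 2 (finDim K (ι →₀ K)) where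
  wellFoundedLT := inferInstance
  mk_le := le_rfl
  card_con := (finDim_isSimple K (ι →₀ K)).card_latticeCon
  satisfies _ _ h := h
  exists_hom := ⟨LatticeHom.id _, Function.injective_id⟩

variable [Countable K]

variable (K ι) in
theorem isTowerOver_finDimTop :
    IsTowerOver (finDim K (ι →₀ K)) 3 (finDimTop K (ι →₀ K)) where
  wellFoundedLT := inferInstance
  mk_le := mk_finDimTop_le.trans_eq mk_finDim.symm
  card_con := card_latticeCon_finDimTop (not_finiteDimensional_finsupp K ι)
  satisfies _ _ h :=
    subtype_satisfies _ (h.submodule (not_finiteDimensional_finsupp K ι) (ι →₀ K))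
  exists_hom := ⟨finDimInclusion K _, finDimInclusion_injective⟩

variable (K ι) in
theorem isTowerOver_boolean (k : ℕ) :
    IsTowerOver (finDim K (ι →₀ K)) (2 ^ k * 2)
      (gluedSum (Set (Fin k)) (finDim K (ι →₀ K))) where
  wellFoundedLT := inferInstance
  mk_le := (mk_le_of_injective Subtype.val_injective).trans (by
    rw [mk_prod, lift_id', mk_finDim]
    refine mul_le_of_le (aleph0_le_mk ι) ?_ le_rfl
    exact (lift_le_aleph0.2 mk_le_aleph0).trans (aleph0_le_mk ι))
  card_con := by
    rw [card_latticeCon_gluedSum, card_latticeCon_set, (isTowerOver_finDim K ι).card_con,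
      Nat.card_eq_fintype_card, Fintype.card_fin]
  satisfies s t h := subtype_satisfies _ ((h.prop.set (Fin k)).prod h)
  exists_hom := ⟨gluedInr _ _, gluedInr_injective _ _⟩

theorem isTowerOver_tower (m n : ℕ) (hmn : 1 ≤ m + n) :
    IsTowerOver (finDim K (ι →₀ K)) (2 ^ m * 3 ^ n) (tower K (ι →₀ K) m n).carrier := by
  have hE : ℵ₀ ≤ #(finDim K (ι →₀ K)) := (aleph0_le_mk ι).trans_eq mk_finDim.symm
  induction n with
  | zero =>
    match m, hmn with
    | 1, _ => exact isTowerOver_finDim K ι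
    | m + 2, _ =>
      rw [pow_zero, mul_one, pow_succ]
      exact isTowerOver_boolean K ι (m + 1)
  | succ n ih =>
    match m, n, ih with
    | 0, 0, _ => exact isTowerOver_finDimTop K ι
    | 0, n + 1, ih =>
      have := (isTowerOver_finDimTop K ι).gluedSum (ih (by omega)) hE
      rwa [mul_left_comm, ← pow_succ'] at this
    | m + 1, n, ih =>
      have := (isTowerOver_finDimTop K ι).gluedSum (ih (by omega)) hE
      rw [mul_left_comm, ← pow_succ'] at this
      rwa [tower]

instance (p : ℕ) : Countable (PrimeField p) :=
  match p with
  | 0 => inferInstanceAs (Countable ℚ)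
  | p + 1 => inferInstanceAs (Countable (Fin (p + 1)))

/-! ### A distributive lattice with the greatest possible number of congruences -/

theorem isRepresentedBy_finset (ι : Type u) [DecidableEq ι] [Infinite ι] :
    IsRepresentedBy (2 ^ #ι) #ι (2 ^ #ι) (Finset ι) := by
  have hmk : #(Finset ι) = #ι := mk_finset_of_infinite ι
  refine ⟨le_antisymm ((mk_latticeCon_le _).trans_eq (by rw [hmk])) ?_,
    (mk_pfilter _).trans hmk, le_antisymm ((mk_ideal_le _).trans_eq (by rw [hmk])) ?_⟩
  · let f : LatticeHom (Finset ι) (Set ι) :=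
      { toFun := fun s => s
        map_sup' := Finset.coe_union
        map_inf' := Finset.coe_inter }
    rw [← mk_set]
    refine mk_le_of_injective (f := fun S => comapCon f (sdiffCon S)) fun S T h => ?_
    have key : ∀ (S : Set ι) (i : ι), (comapCon f (sdiffCon S)).r ∅ {i} ↔ i ∈ S := fun S i => by
      change ((∅ : Finset ι) : Set ι) ∪ S = (({i} : Finset ι) : Set ι) ∪ S ↔ i ∈ S
      rw [Finset.coe_empty, Finset.coe_singleton, Set.empty_union, Set.singleton_union, eq_comm,
        Set.insert_eq_self]
    have h : comapCon f (sdiffCon S) = comapCon f (sdiffCon T) := h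
    exact Set.ext fun i => by rw [← key, h, key]
  · have hA : ∀ A : Set ι, Order.IsIdeal {s : Finset ι | (s : Set ι) ⊆ A} := fun A => by
      refine ⟨fun s t h hs => (Finset.coe_subset.2 h).trans hs, ⟨∅, by simp⟩, fun s hs t ht => ?_⟩
      refine ⟨s ⊔ t, ?_, le_sup_left, le_sup_right⟩
      change ((s ∪ t : Finset ι) : Set ι) ⊆ A
      rw [Finset.coe_union]
      exact Set.union_subset hs ht
    rw [← mk_set]
    refine mk_le_of_injective (f := fun A => (hA A).toIdeal) fun A B h => ?_
    have key : ∀ (A : Set ι) (i : ι), {i} ∈ (hA A).toIdeal ↔ i ∈ A := fun A i => by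
      change ((({i} : Finset ι) : Set ι) ⊆ A) ↔ i ∈ A
      simp
    have h : (hA A).toIdeal = (hA B).toIdeal := h
    exact Set.ext fun i => by rw [← key, h, key]

end CFI

/-! ### Triples of cardinals represented by lattices -/

theorem theorem1 (κ : Cardinal.{u}) (hκ : Cardinal.aleph0 ≤ κ) :
    (∀ c : Cardinal.{u}, 2 ≤ c → c ≤ κ →
      ∃ (L : Type u) (_ : Lattice L), CFI.IsRepresentedBy c κ (2 ^ κ) L) ∧
    (∃ (L : Type u) (_ : DistribLattice L), CFI.IsRepresentedBy (2 ^ κ) κ (2 ^ κ) L) ∧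
    (∀ (p : ℕ) [Fact (p = 0 ∨ p.Prime)] (m n : ℕ), 1 ≤ m + n →
      IsModularLattice (CFI.towerLattice p m n κ) ∧
      CFI.IsRepresentedBy (2 ^ m * 3 ^ n) κ (2 ^ κ) (CFI.towerLattice p m n κ) ∧
      CFI.freeseVariety p (CFI.towerLattice p m n κ) ∧
      CFI.Generates (CFI.towerLattice p m n κ) (CFI.freeseVariety p) ∧
      (m = 1 → n = 0 →
        CFI.IsSimple (CFI.towerLattice p m n κ) ∧
        CFI.IsRelativelyComplemented (CFI.towerLattice p m n κ))) := by
  have hinf : Infinite κ.out := Cardinal.infinite_iff.2 (by rwa [Cardinal.mk_out])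
  refine ⟨fun c hc hcκ => ?_, ?_, fun p hp m n hmn => ?_⟩
  · obtain ⟨μ, rfl⟩ := exists_add_of_le hc
    obtain ⟨_, hwf⟩ := exists_wellFoundedLT μ.out
    exact ⟨CFI.Nest (CFI.finDim ℚ (κ.out →₀ ℚ)) μ.out, inferInstance,
      CFI.Nest.isRepresentedBy hκ (CFI.finDim_isSimple ℚ _)
        (by rw [CFI.mk_finDim, Cardinal.mk_out]) (by rw [CFI.mk_ideal_finDim, Cardinal.mk_out])
        (by rw [Cardinal.mk_out, add_comm]) hcκ⟩
  · classical
    have := CFI.isRepresentedBy_finset κ.out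
    rw [Cardinal.mk_out] at this
    exact ⟨Finset κ.out, inferInstance, this⟩
  · have hV := CFI.not_finiteDimensional_finsupp (CFI.PrimeField p) κ.out
    have hL : CFI.IsTowerOver (CFI.finDim (CFI.PrimeField p) (κ.out →₀ CFI.PrimeField p))
        (2 ^ m * 3 ^ n) (CFI.towerLattice p m n κ) := CFI.isTowerOver_tower m n hmn
    have hE : Cardinal.mk (CFI.finDim (CFI.PrimeField p) (κ.out →₀ CFI.PrimeField p)) = κ := by
      rw [CFI.mk_finDim, Cardinal.mk_out]
    have hmem : CFI.freeseVariety p (CFI.towerLattice p m n κ) := fun s t h =>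
      hL.satisfies s t (CFI.subtype_satisfies _ (h _
        ⟨_, inferInstance, inferInstance, ⟨CFI.submoduleEquivModuleCon _ _⟩⟩))
    refine ⟨?_, ?_, hmem, fun s t => ⟨fun h M _ hM => hM s t ?_, fun h => h _ hmem⟩, ?_⟩
    · have := CFI.isModularLattice_of_satisfies
        (CFI.subtype_satisfies (CFI.finDim (CFI.PrimeField p) (κ.out →₀ CFI.PrimeField p))
          (CFI.satisfies_modular _))
      exact hL.isModularLattice
    · have := hL.isRepresentedBy (by positivity) (by rw [CFI.mk_ideal_finDim, CFI.mk_finDim])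
      rw [hE] at this
      exact_mod_cast this
    · rintro N _ ⟨W, _, _, ⟨e⟩⟩
      exact (((hL.satisfies_iff s t).1 h).submodule hV W).of_injective
        (e.trans (CFI.submoduleEquivModuleCon _ W).symm) (OrderIso.injective _)
    · rintro rfl rfl
      exact ⟨CFI.finDim_isSimple _ _, CFI.finDim_isRelativelyComplemented _ _⟩
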